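/- Let $H_1=\mathbb R^3$ be the Heisenberg group with frame $\mathring e_1=\partial_x+y\partial_z$, $\mathring e_2=\partial_y-x\partial_z$, $T=\partial_z$, contact form $\Theta=dz+x\,dy-y\,dx$, contact bundle $\xi=\ker\Theta$, CR structure $J\mathring e_1=\mathring e_2$, $J\mathring e_2=-\mathring e_1$ on $\xi$, the metric making $\mathring e_1,\mathring e_2,T$ orthonormal, and the connection $\nabla$ making them parallel. A Heisenberg rigid motion is a diffeomorphism of $H_1$ preserving $\Theta$ and $J$. Everything is $C^\infty$. For a surface, a point is regular if the tangent plane differs from $\xi$ there; near a regular point let $e_1$ be a unit vector field tangent to the surface and to $\xi$ (a choice of sign), $e_2=Je_1$, let $H$ (the $p$-mean curvature) be given by $\nabla_{e_1}e_2=-He_1$, and let $\alpha$ be the function such that $\alpha e_2+T$ is tangent to the surface; put $\hat e_2=(\alpha e_2+T)/\sqrt{1+\alpha^2}$. The surface is $p$-minimal if $H=0$ on its regular part. Let $I\subset\mathbb R$ be an open interval (possibly unbounded) and $\zeta_1,\zeta_2:I\to\mathbb R$ smooth with $\zeta_2(y)\neq0$ for all $y\in I$. Smooth functions $(x,y)$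 on an immersed $p$-minimal surface without singular points, which are local coordinates near each of its points, are called normal coordinates with $\zeta_1$ (respectively $\zeta_1,\zeta_2$) as invariants if $y$ takes values in $I$, $\partial_x=e_1$ is a characteristic direction as above, $\hat e_2=b\,\partial_y$, and - special type I: $x+\zeta_1(y)\ne0$, $\alpha=\dfrac1{x+\zeta_1(y)}$, $b=\dfrac{\alpha^2}{\sqrt{1+\alpha^2}}$; - special type II: $2x+\zeta_1(y)\neq0$, $\alpha=\dfrac1{2x+\zeta_1(y)}$, $b=\dfrac{|\alpha|}{\sqrt{1+\alpha^2}}$; - general type: $(x+\zeta_1(y))^2+\zeta_2(y)\ne0$, $\alpha=\dfrac{x+\zeta_1(y)}{(x+\zeta_1(y))^2+\zeta_2(y)}$, $b=\dfrac1{\sqrt{(x+\zeta_1(y))^2+\big((x+\zeta_1(y))^2+\zeta_2(y)\big)^2}}$ (which equals $\dfrac{|\alpha|}{|x+\zeta_1(y)|\sqrt{1+\alpha^2}}$ where $x+\zeta_1(y)\ne0$). The general type is of type I if $\zeta_2(y)>0$ at all points of the surface; of type II if at all its points $\zeta_2(y)<0$ and either $x<-\zeta_1(y)-\sqrt{-\zeta_2(y)}$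 or $x>-\zeta_1(y)+\sqrt{-\zeta_2(y)}$; of type III if at all its points $\zeta_2(y)<0$ and $-\zeta_1(y)-\sqrt{-\zeta_2(y)}<x<-\zeta_1(y)+\sqrt{-\zeta_2(y)}$. Consider the following domains in $\{(x,y):y\in I\}$: $U_I^{\pm}=\{\pm(x+\zeta_1(y))>0\}$ and $U_{II}^\pm=\{\pm(2x+\zeta_1(y))>0\}$; if $\zeta_2>0$ on $I$, $V_I=\mathbb R\times I$; if $\zeta_2<0$ on $I$, $V_{II}^-=\{x<-\zeta_1(y)-\sqrt{-\zeta_2(y)}\}$, $V_{II}^+=\{x>-\zeta_1(y)+\sqrt{-\zeta_2(y)}\}$ and $V_{III}=\{-\zeta_1(y)-\sqrt{-\zeta_2(y)}<x<-\zeta_1(y)+\sqrt{-\zeta_2(y)}\}$. **Theorem.** On each of these domains there is an immersion $X$ into $H_1$, unique up to a Heisenberg rigid motion, which is a $p$-minimal surface for which the parameters $(x,y)$ are normal coordinates of the corresponding type (special type I on $U_I^\pm$, special type II on $U_{II}^\pm$, general type on $V_I,V_{II}^\pm,V_{III}$) with invariants $\zeta_1$ (and $\zeta_2$). Denote the resulting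 immersed $p$-minimal surfaces, defined up to rigid motion, by $S_I^\pm(\zeta_1)$, $S_{II}^\pm(\zeta_1)$, $\Sigma_I(\zeta_1,\zeta_2)$, $\Sigma_{II}^\pm(\zeta_1,\zeta_2)$, $\Sigma_{III}(\zeta_1,\zeta_2)$. They are maximal: let $F:M\to H_1$ be a connected immersed $p$-minimal surface with normal coordinates $\varphi=(x,y):M\to\mathbb R^2$ having $\zeta_1$ (and $\zeta_2$) as invariants. If it is of special type I, it is part of $S_I^-(\zeta_1)$ or of $S_I^+(\zeta_1)$; if of special type II, part of $S_{II}^-(\zeta_1)$ or of $S_{II}^+(\zeta_1)$; if of type I, part of $\Sigma_I(\zeta_1,\zeta_2)$; if of type II, part of $\Sigma_{II}^-(\zeta_1,\zeta_2)$ or of $\Sigma_{II}^+(\zeta_1,\zeta_2)$; if of type III, part of $\Sigma_{III}(\zeta_1,\zeta_2)$. Here "part of" the surface given by $X$ on the domain $D$ means that $\varphi(M)\subset D$ and $F=\Phi\circ X\circ\varphi$ for a Heisenberg rigid motion $\Phi$. -/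

import Mathlib

open Set
open scoped ContDiff Manifold

noncomputable section

namespace Heis

/-! ### The Heisenberg group as a pseudohermitian manifold -/

/-- The underlying manifold `ℝ³` of the Heisenberg group, with coordinates `(x, y, z)`. -/
abbrev H1 : Type := ℝ × ℝ × ℝ

/-- The left invariant field `∂/∂x + y ∂/∂z`. -/
def E1 (p : H1) : H1 := (1, 0, p.2.1)

/-- The left invariant field `∂/∂y - x ∂/∂z`. -/
def E2 (p : H1) : H1 := (0, 1, -p.1)

/-- The left invariant field `∂/∂z`. -/
def T (_p : H1) : H1 := (0, 0, 1)

/-- The contact form `dz + x dy - y dx`, at the point `p`, applied to `v`. -/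
def Theta (p v : H1) : ℝ := v.2.2 + p.1 * v.2.1 - p.2.1 * v.1

/-- The components of a tangent vector `v` at `p` in the frame `(E1, E2, T)`. -/
def frameCoord (p v : H1) : ℝ × ℝ × ℝ := (v.1, v.2.1, Theta p v)

/-- The tangent vector at `p` with the given components in the frame `(E1, E2, T)`. -/
def ofFrame (p : H1) (k : ℝ × ℝ × ℝ) : H1 := k.1 • E1 p + k.2.1 • E2 p + k.2.2 • T p

lemma ofFrame_frameCoord (p v : H1) : ofFrame p (frameCoord p v) = v := by
  ext
  · simp [ofFrame, frameCoord, E1, E2, T]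
  · simp [ofFrame, frameCoord, E1, E2, T]
  · simp only [ofFrame, frameCoord, E1, E2, T, Theta, Prod.snd_add, Prod.smul_snd, smul_eq_mul]
    ring

/-- The contact plane at `p`: the vectors killed by the contact form. -/
def contactPlane (p : H1) : Set H1 := {v | Theta p v = 0}

/-- The CR structure: `J E1 = E2`, `J E2 = -E1` on the contact planes.
(It is only ever applied to contact vectors; by convention it kills `T`.) -/
def J (p v : H1) : H1 := ofFrame p (-v.2.1, v.1, 0)

/-- The adapted metric, for which `E1, E2, T` are orthonormal. -/
def metric (p v w : H1) : ℝ := v.1 * w.1 + v.2.1 * w.2.1 + Theta p v * Theta p w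

/-- Heisenberg rigid motions: the diffeomorphisms of `H1` that preserve the contact form and the
CR structure. -/
structure IsRigidMotion (Φ : H1 → H1) : Prop where
  smooth : ContDiff ℝ ∞ Φ
  exists_inverse : ∃ Ψ : H1 → H1, ContDiff ℝ ∞ Ψ ∧
    Function.LeftInverse Ψ Φ ∧ Function.RightInverse Ψ Φ
  pullback_Theta : ∀ p v, Theta (Φ p) (fderiv ℝ Φ p v) = Theta p v
  commutes_J : ∀ p, ∀ v ∈ contactPlane p, fderiv ℝ Φ p (J p v) = J (Φ p) (fderiv ℝ Φ p v)

/-! ### Parametrized surfaces `X : W → H1`, `W` open in the `(x, y)`-plane -/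

/-- The tangent plane of the parametrized surface `X` at the parameter `q`. -/
def tangentPlane (X : ℝ × ℝ → H1) (q : ℝ × ℝ) : Set H1 := range (fderiv ℝ X q)

/-- `q` is a singular point if the tangent plane is the contact plane; else it is regular. -/
def IsRegularPt (X : ℝ × ℝ → H1) (q : ℝ × ℝ) : Prop := tangentPlane X q ≠ contactPlane (X q)

/-- The flat connection for which `E1, E2, T` are parallel: the derivative at `q`, in the parameter
direction `u`, of the vector field `V` along `X`. -/
def nabla (X V : ℝ × ℝ → H1) (q u : ℝ × ℝ) : H1 :=
  ofFrame (X q) (fderiv ℝ (fun q' => frameCoord (X q') (V q')) q u)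

/-- `e₁` is a characteristic direction of `X` over `W`: all points are regular, and `e₁` is a smooth
unit vector field which is tangent to the surface and to the contact planes. -/
structure IsCharField (X : ℝ × ℝ → H1) (W : Set (ℝ × ℝ)) (e₁ : ℝ × ℝ → H1) : Prop where
  regular : ∀ q ∈ W, IsRegularPt X q
  smooth : ContDiffOn ℝ ∞ e₁ W
  tangent : ∀ q ∈ W, e₁ q ∈ tangentPlane X q
  contact : ∀ q ∈ W, e₁ q ∈ contactPlane (X q)
  unit : ∀ q ∈ W, metric (X q) (e₁ q) (e₁ q) = 1

/-- The field `e₂ = J e₁` along `X`. -/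
def e2 (X e₁ : ℝ × ℝ → H1) (q : ℝ × ℝ) : H1 := J (X q) (e₁ q)

/-- `h` is the `p`-mean curvature over `W`, for the characteristic direction `e₁`:
`∇_{e₁} e₂ = - h e₁`. -/
def HasPMeanCurvature (X : ℝ × ℝ → H1) (W : Set (ℝ × ℝ)) (e₁ : ℝ × ℝ → H1)
    (h : ℝ × ℝ → ℝ) : Prop :=
  ∀ q ∈ W, ∀ u, fderiv ℝ X q u = e₁ q → nabla X (e2 X e₁) q u = -(h q) • e₁ q

/-- `X` is `p`-minimal over `W`: the `p`-mean curvature vanishes on the regular part. -/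
def IsPMinimalOn (X : ℝ × ℝ → H1) (W : Set (ℝ × ℝ)) : Prop :=
  ∀ V ⊆ W, IsOpen V → ∀ e₁, IsCharField X V e₁ → HasPMeanCurvature X V e₁ 0

/-- `α` is the `α`-function over `W`: `α e₂ + T` is tangent to the surface. -/
def IsAlphaFunction (X : ℝ × ℝ → H1) (W : Set (ℝ × ℝ)) (e₁ : ℝ × ℝ → H1)
    (α : ℝ × ℝ → ℝ) : Prop :=
  ∀ q ∈ W, α q • e2 X e₁ q + T (X q) ∈ tangentPlane X q

/-- The unit tangent field `ê₂ = (α e₂ + T) / √(1 + α²)`. -/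
def hatE2 (X e₁ : ℝ × ℝ → H1) (α : ℝ × ℝ → ℝ) (q : ℝ × ℝ) : H1 :=
  (1 / √(1 + α q ^ 2)) • (α q • e2 X e₁ q + T (X q))

/-- The coordinate field `∂/∂x`, as a vector field along `X`. -/
def partialX (X : ℝ × ℝ → H1) (q : ℝ × ℝ) : H1 := fderiv ℝ X q (1, 0)

/-- The coordinate field `∂/∂y`, as a vector field along `X`. -/
def partialY (X : ℝ × ℝ → H1) (q : ℝ × ℝ) : H1 := fderiv ℝ X q (0, 1)

/-- The parameters `(x, y)` are compatible coordinates, `e₁ = ∂/∂x` being a characteristic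
direction; with respect to them the surface has the `α`-function `α`, and its induced metric is
represented by `a`, `b`, that is `ê₂ = a ∂/∂x + b ∂/∂y`. -/
structure IsCompatibleParam (X : ℝ × ℝ → H1) (W : Set (ℝ × ℝ)) (α a b : ℝ × ℝ → ℝ) : Prop where
  char : IsCharField X W (partialX X)
  alpha : IsAlphaFunction X W (partialX X) α
  metricRep : ∀ q ∈ W, hatE2 X (partialX X) α q = a q • partialX X q + b q • partialY X q

/-! ### Normal forms -/

/-- The pair `α`, `b` prescribed in normal coordinates. -/
structure NormalForm where
  alpha : ℝ × ℝ → ℝ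
  b : ℝ × ℝ → ℝ

/-- Special type I: `α = 1 / (x + ζ₁)`, `b = α² / √(1 + α²)`. -/
def specialI (ζ₁ : ℝ → ℝ) : NormalForm where
  alpha q := 1 / (q.1 + ζ₁ q.2)
  b q := (1 / (q.1 + ζ₁ q.2)) ^ 2 / √(1 + (1 / (q.1 + ζ₁ q.2)) ^ 2)

/-- Special type II: `α = 1 / (2x + ζ₁)`, `b = |α| / √(1 + α²)`. -/
def specialII (ζ₁ : ℝ → ℝ) : NormalForm where
  alpha q := 1 / (2 * q.1 + ζ₁ q.2)
  b q := |1 / (2 * q.1 + ζ₁ q.2)| / √(1 + (1 / (2 * q.1 + ζ₁ q.2)) ^ 2)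

/-- General type: `α = (x + ζ₁) / ((x + ζ₁)² + ζ₂)` and
`b = 1 / √((x + ζ₁)² + ((x + ζ₁)² + ζ₂)²)`. This `b` is the smooth extension to the
points with `x + ζ₁ = 0` of `|α| / (|x + ζ₁| √(1 + α²))`. -/
def general (ζ₁ ζ₂ : ℝ → ℝ) : NormalForm where
  alpha q := (q.1 + ζ₁ q.2) / ((q.1 + ζ₁ q.2) ^ 2 + ζ₂ q.2)
  b q := 1 / √((q.1 + ζ₁ q.2) ^ 2 + ((q.1 + ζ₁ q.2) ^ 2 + ζ₂ q.2) ^ 2)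

/-- `X` is parametrized over `W` by normal coordinates with normal form `N` (so `a = 0`). -/
def IsNormalParam (N : NormalForm) (X : ℝ × ℝ → H1) (W : Set (ℝ × ℝ)) : Prop :=
  IsCompatibleParam X W N.alpha 0 N.b

/-- `X` is an immersed `p`-minimal surface with parameter domain `D`, and `(x, y) ∈ D` are normal
coordinates on it, with normal form `N`. -/
structure IsNormalSurface (N : NormalForm) (D : Set (ℝ × ℝ)) (X : ℝ × ℝ → H1) : Prop where
  smooth : ContDiffOn ℝ ∞ X D
  immersion : ∀ q ∈ D, Function.Injective (fderiv ℝ X q)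
  pMinimal : IsPMinimalOn X D
  normal : IsNormalParam N X D

/-! ### The domains of the eight maximal surfaces; `I` is the interval of definition of `ζ₁, ζ₂` -/

def UIminus (I : Set ℝ) (ζ₁ : ℝ → ℝ) : Set (ℝ × ℝ) := {q | q.2 ∈ I ∧ q.1 + ζ₁ q.2 < 0}

def UIplus (I : Set ℝ) (ζ₁ : ℝ → ℝ) : Set (ℝ × ℝ) := {q | q.2 ∈ I ∧ 0 < q.1 + ζ₁ q.2}

def UIIminus (I : Set ℝ) (ζ₁ : ℝ → ℝ) : Set (ℝ × ℝ) := {q | q.2 ∈ I ∧ 2 * q.1 + ζ₁ q.2 < 0}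

def UIIplus (I : Set ℝ) (ζ₁ : ℝ → ℝ) : Set (ℝ × ℝ) := {q | q.2 ∈ I ∧ 0 < 2 * q.1 + ζ₁ q.2}

def VI (I : Set ℝ) : Set (ℝ × ℝ) := {q | q.2 ∈ I}

def VIIminus (I : Set ℝ) (ζ₁ ζ₂ : ℝ → ℝ) : Set (ℝ × ℝ) :=
  {q | q.2 ∈ I ∧ q.1 < -ζ₁ q.2 - √(-ζ₂ q.2)}

def VIIplus (I : Set ℝ) (ζ₁ ζ₂ : ℝ → ℝ) : Set (ℝ × ℝ) :=
  {q | q.2 ∈ I ∧ -ζ₁ q.2 + √(-ζ₂ q.2) < q.1}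

def VIII (I : Set ℝ) (ζ₁ ζ₂ : ℝ → ℝ) : Set (ℝ × ℝ) :=
  {q | q.2 ∈ I ∧ -ζ₁ q.2 - √(-ζ₂ q.2) < q.1 ∧ q.1 < -ζ₁ q.2 + √(-ζ₂ q.2)}

/-- The surface of normal form `N` over the domain `D` exists as an immersed `p`-minimal surface,
and it is unique up to a Heisenberg rigid motion. -/
def IsWellDefinedSurface (N : NormalForm) (D : Set (ℝ × ℝ)) : Prop :=
  (∃ X, IsNormalSurface N D X) ∧
  ∀ X X', IsNormalSurface N D X → IsNormalSurface N D X' →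
    ∃ Φ, IsRigidMotion Φ ∧ ∀ q ∈ D, X' q = Φ (X q)

/-! ### Surfaces `F : M → H1`, with `M` a 2-manifold -/

section Surfaces

variable {M : Type*} [TopologicalSpace M] [ChartedSpace (ℝ × ℝ) M]

/-- `σ` is a local parametrization of `M` (a local diffeomorphism) over the open set `W`. -/
def IsLocalParam (W : Set (ℝ × ℝ)) (σ : ℝ × ℝ → M) : Prop :=
  IsOpen W ∧ IsLocalDiffeomorphOn 𝓘(ℝ, ℝ × ℝ) 𝓘(ℝ, ℝ × ℝ) ∞ σ W

/-- `F` is an immersed `p`-minimal surface: a smooth immersion of the 2-manifold `M` which is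
`p`-minimal in local parameters. -/
structure IsPMinimalSurface (F : M → H1) : Prop where
  smooth : ContMDiff 𝓘(ℝ, ℝ × ℝ) 𝓘(ℝ, H1) ∞ F
  immersion : ∀ p, Function.Injective (mfderiv 𝓘(ℝ, ℝ × ℝ) 𝓘(ℝ, H1) F p)
  pMinimal : ∀ (W : Set (ℝ × ℝ)) (σ : ℝ × ℝ → M), IsLocalParam W σ → IsPMinimalOn (F ∘ σ) W

/-- `φ = (x, y) : M → ℝ²` is a normal coordinate system on the surface `F`, with normal form `N`:
`x, y` are smooth functions on the surface which are local coordinates near every point, and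
wherever they are used as parameters, the surface is in normal form `N`. -/
structure IsNormalCoordinates (N : NormalForm) (F : M → H1) (φ : M → ℝ × ℝ) : Prop where
  localDiffeo : IsLocalDiffeomorph 𝓘(ℝ, ℝ × ℝ) 𝓘(ℝ, ℝ × ℝ) ∞ φ
  normal : ∀ (W : Set (ℝ × ℝ)) (σ : ℝ × ℝ → M), IsLocalParam W σ → (∀ q ∈ W, φ (σ q) = q) →
    IsNormalParam N (F ∘ σ) W

/-- In the normal coordinates `φ` the surface is of special type I with invariant `ζ₁`. -/
def IsOfSpecialTypeI (I : Set ℝ) (ζ₁ : ℝ → ℝ) (F : M → H1) (φ : M → ℝ × ℝ) : Prop :=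
  IsNormalCoordinates (specialI ζ₁) F φ ∧ ∀ p, (φ p).2 ∈ I ∧ (φ p).1 + ζ₁ (φ p).2 ≠ 0

/-- In the normal coordinates `φ` the surface is of special type II with invariant `ζ₁`. -/
def IsOfSpecialTypeII (I : Set ℝ) (ζ₁ : ℝ → ℝ) (F : M → H1) (φ : M → ℝ × ℝ) : Prop :=
  IsNormalCoordinates (specialII ζ₁) F φ ∧ ∀ p, (φ p).2 ∈ I ∧ 2 * (φ p).1 + ζ₁ (φ p).2 ≠ 0

/-- In the normal coordinates `φ` the surface is of type I with invariants `ζ₁, ζ₂`. -/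
def IsOfTypeI (I : Set ℝ) (ζ₁ ζ₂ : ℝ → ℝ) (F : M → H1) (φ : M → ℝ × ℝ) : Prop :=
  IsNormalCoordinates (general ζ₁ ζ₂) F φ ∧ ∀ p, (φ p).2 ∈ I ∧ 0 < ζ₂ (φ p).2

/-- In the normal coordinates `φ` the surface is of type II with invariants `ζ₁, ζ₂`. -/
def IsOfTypeII (I : Set ℝ) (ζ₁ ζ₂ : ℝ → ℝ) (F : M → H1) (φ : M → ℝ × ℝ) : Prop :=
  IsNormalCoordinates (general ζ₁ ζ₂) F φ ∧ ∀ p, (φ p).2 ∈ I ∧ ζ₂ (φ p).2 < 0 ∧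
    ((φ p).1 < -ζ₁ (φ p).2 - √(-ζ₂ (φ p).2) ∨ -ζ₁ (φ p).2 + √(-ζ₂ (φ p).2) < (φ p).1)

/-- In the normal coordinates `φ` the surface is of type III with invariants `ζ₁, ζ₂`. -/
def IsOfTypeIII (I : Set ℝ) (ζ₁ ζ₂ : ℝ → ℝ) (F : M → H1) (φ : M → ℝ × ℝ) : Prop :=
  IsNormalCoordinates (general ζ₁ ζ₂) F φ ∧ ∀ p, (φ p).2 ∈ I ∧ ζ₂ (φ p).2 < 0 ∧
    -ζ₁ (φ p).2 - √(-ζ₂ (φ p).2) < (φ p).1 ∧ (φ p).1 < -ζ₁ (φ p).2 + √(-ζ₂ (φ p).2)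

/-- The surface `F`, with normal coordinates `φ`, is part of the surface of normal form `N` over
`D`, up to a Heisenberg rigid motion, under the identification given by the normal coordinates:
`φ` maps into `D`, the surface over `D` exists, and `F = Φ ∘ X ∘ φ` for a rigid motion `Φ`, whatever
representative `X` of it is chosen. In particular `F(M) ⊆ Φ(X(D))`. -/
def IsPartOf (F : M → H1) (φ : M → ℝ × ℝ) (N : NormalForm) (D : Set (ℝ × ℝ)) : Prop :=
  (∀ p, φ p ∈ D) ∧ (∃ X, IsNormalSurface N D X) ∧
  ∀ X, IsNormalSurface N D X → ∃ Φ, IsRigidMotion Φ ∧ ∀ p, F p = Φ (X (φ p))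

end Surfaces

end Heis

end

noncomputable section

namespace Heis

open Filter Topology

/-! ### Rotations followed by left translations -/

/-! In all the normal forms `α = A / B` and `b √(1 + α²) = 1 / B`, where `A = ε x + f(y)`, `B = ε x²
+ 2 f(y) x + g(y) > 0` and the constant `ε` is `0`, `1` or `-1`. The equation `ê₂ = b ∂_y` then
reads `∂_y = A e₂ + B T`, so one argument covers all eight surfaces (`HasCoefficients`).

Let `(c, s)` be the components of `∂_x` in the frame of the contact planes. By `p`-minimality they
do not depend on `x`. The horizontal part of `∂_y` is `A (-s, c)`, so symmetry of the mixed
derivatives and `A_x = ε` give `∂_y (c, s) = ε (-s, c)`: the direction turns at the constant speed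
`ε`.

Uniqueness (`IsNormalSurface.exists_eq_rigid`): for two surfaces with the same normal form the
directions differ by a constant rotation. Up to this rotation the projections to the plane have the
same differential, hence differ by a translation. The contact form takes the same values `0` and `B`
on `∂_x` and `∂_y`, which fixes the third coordinate up to a constant.

Existence (`exists_isNormalSurface`): with angle `ε y`, the surface is ruled by horizontal lines
through a curve found by integration over `I`; the relation `B_x = 2 A` makes this consistent.

Maximality: local inverses of `φ` reduce to parametrized surfaces, so `F` is locally congruent to `X
∘ φ`. A motion is determined by its effect on any open piece (`rigid_unique`), so the local motions
agree on the connected `M`. Connectedness also selects the sign, hence the domain. -/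

/-- The linear part of `rigid k t`. -/
def rigidLinear (k : ℝ × ℝ) (t : H1) : H1 →L[ℝ] H1 :=
  let px := ContinuousLinearMap.fst ℝ ℝ (ℝ × ℝ)
  let py := (ContinuousLinearMap.fst ℝ ℝ ℝ).comp (ContinuousLinearMap.snd ℝ ℝ (ℝ × ℝ))
  let pz := (ContinuousLinearMap.snd ℝ ℝ ℝ).comp (ContinuousLinearMap.snd ℝ ℝ (ℝ × ℝ))
  (k.1 • px - k.2 • py).prod ((k.2 • px + k.1 • py).prod
    (pz - t.1 • (k.2 • px + k.1 • py) + t.2.1 • (k.1 • px - k.2 • py)))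

/-- The rotation with cosine and sine `k` about the `z`-axis, followed by the left translation
by `t`. -/
def rigid (k : ℝ × ℝ) (t p : H1) : H1 := t + rigidLinear k t p

lemma rigidLinear_apply (k : ℝ × ℝ) (t v : H1) : rigidLinear k t v =
    (k.1 * v.1 - k.2 * v.2.1, k.2 * v.1 + k.1 * v.2.1,
      v.2.2 - t.1 * (k.2 * v.1 + k.1 * v.2.1) + t.2.1 * (k.1 * v.1 - k.2 * v.2.1)) := rfl

lemma rigid_apply (k : ℝ × ℝ) (t p : H1) : rigid k t p =
    (t.1 + (k.1 * p.1 - k.2 * p.2.1), t.2.1 + (k.2 * p.1 + k.1 * p.2.1),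
      t.2.2 + (p.2.2 - t.1 * (k.2 * p.1 + k.1 * p.2.1) + t.2.1 * (k.1 * p.1 - k.2 * p.2.1))) := rfl

lemma hasFDerivAt_rigid (k : ℝ × ℝ) (t p : H1) : HasFDerivAt (rigid k t) (rigidLinear k t) p :=
  (rigidLinear k t).hasFDerivAt.const_add t

lemma contDiff_rigid (k : ℝ × ℝ) (t : H1) : ContDiff ℝ ∞ (rigid k t) :=
  contDiff_const.add (rigidLinear k t).contDiff

lemma isRigidMotion_rigid {k : ℝ × ℝ} (hk : k.1 ^ 2 + k.2 ^ 2 = 1) (t : H1) :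
    IsRigidMotion (rigid k t) where
  smooth := contDiff_rigid k t
  exists_inverse := by
    -- With `R` the rotation, which is a group automorphism, the inverse of `p ↦ t · R p` is `p ↦
    -- (R⁻¹ t)⁻¹ · R⁻¹ p`, and group inversion is negation.
    refine ⟨rigid (k.1, -k.2) (-(k.1 * t.1 + k.2 * t.2.1), k.2 * t.1 - k.1 * t.2.1, -t.2.2),
      contDiff_rigid _ _, fun p => ?_, fun p => ?_⟩
    all_goals
      obtain ⟨x, y, z⟩ := p
      simp only [rigid_apply, Prod.mk.injEq]
      refine ⟨?_, ?_, ?_⟩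
    · linear_combination x * hk
    · linear_combination y * hk
    · linear_combination (x * (k.2 * t.1 - k.1 * t.2.1) + y * (k.1 * t.1 + k.2 * t.2.1)) * hk
    · linear_combination (x - t.1) * hk
    · linear_combination (y - t.2.1) * hk
    · ring
  pullback_Theta p v := by
    rw [(hasFDerivAt_rigid k t p).fderiv]
    simp only [Theta, rigid_apply, rigidLinear_apply]
    linear_combination (p.1 * v.2.1 - p.2.1 * v.1) * hk
  commutes_J p v _ := by
    rw [(hasFDerivAt_rigid k t p).fderiv]
    simp only [J, ofFrame, E1, E2, T, rigid_apply, rigidLinear_apply, Prod.smul_mk, Prod.mk_add_mk,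
      smul_eq_mul, Prod.mk.injEq]
    refine ⟨by ring, by ring, ?_⟩
    linear_combination (v.2.1 * p.2.1 + v.1 * p.1) * hk

/-! ### Normal forms with polynomial coefficients -/

/-- The rotational part of `∂/∂y`. -/
def coefA (ε : ℝ) (f : ℝ → ℝ) (q : ℝ × ℝ) : ℝ := ε * q.1 + f q.2

/-- The `T`-component of `∂/∂y`. -/
def coefB (ε : ℝ) (f g : ℝ → ℝ) (q : ℝ × ℝ) : ℝ := ε * q.1 ^ 2 + 2 * f q.2 * q.1 + g q.2

/-- Over `D`, the normal form `N` says that `∂/∂y = A e₂ + B T`, where `A = ε x + f` and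
`B = ε x² + 2 f x + g`. -/
structure HasCoefficients (N : NormalForm) (I : Set ℝ) (D : Set (ℝ × ℝ)) (ε : ℝ)
    (f g : ℝ → ℝ) : Prop where
  mem : ∀ q ∈ D, q.2 ∈ I
  pos : ∀ q ∈ D, 0 < coefB ε f g q
  alpha : ∀ q ∈ D, N.alpha q = coefA ε f q / coefB ε f g q
  b : ∀ q ∈ D, N.b q * √(1 + N.alpha q ^ 2) = 1 / coefB ε f g q

/-- The first order part of the equations of a normal parametrization. -/
structure FrameEquations (A B : ℝ) (Y : ℝ × ℝ → H1) (q : ℝ × ℝ) : Prop where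
  unit : (partialX Y q).1 ^ 2 + (partialX Y q).2.1 ^ 2 = 1
  contact : Theta (Y q) (partialX Y q) = 0
  fst : (partialY Y q).1 = -(A * (partialX Y q).2.1)
  snd : (partialY Y q).2.1 = A * (partialX Y q).1
  Theta : Theta (Y q) (partialY Y q) = B

lemma Theta_ofFrame (p : H1) (k : ℝ × ℝ × ℝ) : Theta p (ofFrame p k) = k.2.2 := by
  simp only [Theta, ofFrame, E1, E2, T, Prod.smul_mk, Prod.mk_add_mk, smul_eq_mul]
  ring

lemma frameCoord_ofFrame (p : H1) (k : ℝ × ℝ × ℝ) : frameCoord p (ofFrame p k) = k := by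
  refine Prod.ext ?_ (Prod.ext ?_ (Theta_ofFrame p k)) <;>
    simp [frameCoord, ofFrame, E1, E2, T]

lemma ext_Theta {p v w : H1} (h1 : v.1 = w.1) (h2 : v.2.1 = w.2.1) (h3 : Theta p v = Theta p w) :
    v = w := by
  refine Prod.ext h1 (Prod.ext h2 ?_)
  simp only [Theta, h1, h2] at h3
  linarith

lemma frameCoord_e2 (X e : ℝ × ℝ → H1) (q : ℝ × ℝ) :
    frameCoord (X q) (e2 X e q) = (-(e q).2.1, (e q).1, 0) :=
  frameCoord_ofFrame _ _

lemma fderiv_apply_eq_partials {Y : ℝ × ℝ → H1} {q u : ℝ × ℝ} :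
    fderiv ℝ Y q u = u.1 • partialX Y q + u.2 • partialY Y q := by
  rw [partialX, partialY, ← map_smul, ← map_smul, ← map_add]
  simp

variable {N : NormalForm} {I : Set ℝ} {D W : Set (ℝ × ℝ)} {ε : ℝ} {f g ζ₁ ζ₂ : ℝ → ℝ}
  {X Y : ℝ × ℝ → H1}

/-- For `α = A / B` and `b √(1 + α²) = 1 / B`, the equation `ê₂ = b ∂/∂y` means that
`∂/∂y = A e₂ + B T`. -/
lemma HasCoefficients.metricRep_iff (h : HasCoefficients N I D ε f g) {q : ℝ × ℝ} (hq : q ∈ D) :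
    hatE2 Y (partialX Y) N.alpha q = (0 : ℝ × ℝ → ℝ) q • partialX Y q + N.b q • partialY Y q ↔
      partialY Y q = coefA ε f q • e2 Y (partialX Y) q + coefB ε f g q • T (Y q) := by
  have hB := h.pos q hq
  have hα := h.alpha q hq
  have hb := h.b q hq
  set r := √(1 + N.alpha q ^ 2) with hr
  have hr0 : 0 < r := Real.sqrt_pos.2 (by positivity)
  have hb' : N.b q = 1 / (coefB ε f g q * r) := by
    field_simp at hb ⊢
    exact hb
  have key : hatE2 Y (partialX Y) N.alpha q = (1 / (coefB ε f g q * r)) •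
      (coefA ε f q • e2 Y (partialX Y) q + coefB ε f g q • T (Y q)) := by
    rw [hatE2, ← hr, hα, smul_add, smul_add, smul_smul, smul_smul, smul_smul]
    congr 2 <;> field_simp
  rw [key, Pi.zero_apply, zero_smul, zero_add, hb']
  have h0 : (1 / (coefB ε f g q * r)) ≠ 0 := by positivity
  exact ⟨fun h => (smul_right_injective _ h0 h).symm, fun h => by rw [h]⟩

/-- A tangent vector is determined by its first two components and its value under the contact form,
so the vector equation for `∂_y` splits into three scalar ones. -/
lemma frameEquations_iff {A B : ℝ} {q : ℝ × ℝ} : FrameEquations A B Y q ↔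
    metric (Y q) (partialX Y q) (partialX Y q) = 1 ∧ Theta (Y q) (partialX Y q) = 0 ∧
      partialY Y q = A • e2 Y (partialX Y) q + B • T (Y q) := by
  have e2a : (A • e2 Y (partialX Y) q + B • T (Y q)).1 = -(A * (partialX Y q).2.1) := by
    simp [e2, J, ofFrame, E1, E2, T]
  have e2b : (A • e2 Y (partialX Y) q + B • T (Y q)).2.1 = A * (partialX Y q).1 := by
    simp [e2, J, ofFrame, E1, E2, T]
  have e2c : Theta (Y q) (A • e2 Y (partialX Y) q + B • T (Y q)) = B := by
    simp only [Theta, e2, J, ofFrame, E1, E2, T, Prod.smul_mk, Prod.mk_add_mk, smul_eq_mul]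
    ring
  constructor
  · intro h
    refine ⟨?_, h.contact, ext_Theta (h.fst.trans e2a.symm) (h.snd.trans e2b.symm)
      (h.Theta.trans e2c.symm)⟩
    rw [metric, h.contact]
    linear_combination h.unit
  · rintro ⟨h1, h2, h3⟩
    refine ⟨?_, h2, by rw [h3, e2a], by rw [h3, e2b], by rw [h3, e2c]⟩
    rw [metric, h2] at h1
    linear_combination h1

lemma IsNormalParam.frameEquations (h : HasCoefficients N I D ε f g) (hWD : W ⊆ D)
    (hY : IsNormalParam N Y W) {q : ℝ × ℝ} (hq : q ∈ W) :
    FrameEquations (coefA ε f q) (coefB ε f g q) Y q :=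
  frameEquations_iff.2 ⟨hY.char.unit q hq, hY.char.contact q hq,
    (h.metricRep_iff (hWD hq)).1 (hY.metricRep q hq)⟩

/-- The frame equations over `D` characterize the normal parametrizations among the smooth maps. -/
lemma HasCoefficients.isNormalParam (h : HasCoefficients N I D ε f g) (hD : IsOpen D)
    (hY : ContDiffOn ℝ ∞ Y D)
    (hF : ∀ q ∈ D, FrameEquations (coefA ε f q) (coefB ε f g q) Y q) : IsNormalParam N Y D where
  char :=
    { regular := fun q hq e => by
        have : partialY Y q ∈ contactPlane (Y q) := e ▸ ⟨(0, 1), rfl⟩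
        exact (h.pos q hq).ne' ((hF q hq).Theta.symm.trans this)
      smooth := ((contDiffOn_infty_iff_fderiv_of_isOpen hD).1 hY).2.clm_apply contDiffOn_const
      tangent := fun q _ => ⟨(1, 0), rfl⟩
      contact := fun q hq => (hF q hq).contact
      unit := fun q hq => (frameEquations_iff.1 (hF q hq)).1 }
  alpha q hq := by
    -- Dividing `∂_y = A e₂ + B T` by `B` gives `α e₂ + T`.
    refine ⟨(1 / coefB ε f g q) • (0, 1), ?_⟩
    have h0 := (h.pos q hq).ne'
    rw [map_smul, ← partialY, (frameEquations_iff.1 (hF q hq)).2.2, h.alpha q hq, smul_add,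
      smul_smul, smul_smul, one_div_mul_cancel h0, one_smul]
    congr 2
    ring
  metricRep q hq := (h.metricRep_iff hq).2 (frameEquations_iff.1 (hF q hq)).2.2

/-- The contact form kills `∂_x` and equals `B ≠ 0` on `∂_y`, and `∂_x` is nonzero, being a unit
vector. -/
lemma FrameEquations.injective {A B : ℝ} {q : ℝ × ℝ} (hB : B ≠ 0) (hF : FrameEquations A B Y q) :
    Function.Injective (fderiv ℝ Y q) := by
  rw [injective_iff_map_eq_zero]
  intro u hu
  rw [fderiv_apply_eq_partials] at hu
  have h3 : u.2 * B = 0 := by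
    have : Heis.Theta (Y q) (u.1 • partialX Y q + u.2 • partialY Y q) = 0 := by
      rw [hu]; simp [Heis.Theta]
    have e : Heis.Theta (Y q) (u.1 • partialX Y q + u.2 • partialY Y q) =
      u.1 * Heis.Theta (Y q) (partialX Y q) + u.2 * Heis.Theta (Y q) (partialY Y q) := by
      simp only [Heis.Theta, Prod.snd_add, Prod.smul_snd, Prod.fst_add, Prod.smul_fst, smul_eq_mul]
      ring
    rw [e, hF.contact, hF.Theta] at this
    linarith
  have hu2 : u.2 = 0 := (mul_eq_zero.1 h3).resolve_right hB
  rw [hu2, zero_smul, add_zero] at hu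
  refine Prod.ext ((smul_eq_zero.1 hu).resolve_right fun h0 => ?_) hu2
  have := hF.unit
  rw [h0] at this
  norm_num at this

/-! ### Local congruence of normal surfaces with the same normal form -/

lemma IsNormalSurface.mono (hY : IsNormalSurface N D Y) (h : W ⊆ D) : IsNormalSurface N W Y where
  smooth := hY.smooth.mono h
  immersion q hq := hY.immersion q (h hq)
  pMinimal V hV := hY.pMinimal V (hV.trans h)
  normal :=
    { char :=
        { regular := fun q hq => hY.normal.char.regular q (h hq)
          smooth := hY.normal.char.smooth.mono h
          tangent := fun q hq => hY.normal.char.tangent q (h hq)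
          contact := fun q hq => hY.normal.char.contact q (h hq)
          unit := fun q hq => hY.normal.char.unit q (h hq) }
      alpha := fun q hq => hY.normal.alpha q (h hq)
      metricRep := fun q hq => hY.normal.metricRep q (h hq) }

lemma contDiffOn_partialX (hW : IsOpen W) (hY : ContDiffOn ℝ ∞ Y W) :
    ContDiffOn ℝ ∞ (partialX Y) W :=
  ((contDiffOn_infty_iff_fderiv_of_isOpen hW).1 hY).2.clm_apply contDiffOn_const

lemma contDiffOn_partialY (hW : IsOpen W) (hY : ContDiffOn ℝ ∞ Y W) :
    ContDiffOn ℝ ∞ (partialY Y) W :=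
  ((contDiffOn_infty_iff_fderiv_of_isOpen hW).1 hY).2.clm_apply contDiffOn_const

lemma hasFDerivAt_of_contDiffOn {E F : Type*} [NormedAddCommGroup E] [NormedSpace ℝ E]
    [NormedAddCommGroup F] [NormedSpace ℝ F] {h : E → F} {s : Set E} (hh : ContDiffOn ℝ ∞ h s)
    (hs : IsOpen s) {x : E} (hx : x ∈ s) : HasFDerivAt h (fderiv ℝ h x) x :=
  ((hh.differentiableOn (by simp)).differentiableAt (hs.mem_nhds hx)).hasFDerivAt

/-- The mixed second derivatives agree. -/
lemma fderiv_partialX_eq_fderiv_partialY (hW : IsOpen W) (hY : ContDiffOn ℝ ∞ Y W) {q : ℝ × ℝ}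
    (hq : q ∈ W) : fderiv ℝ (partialX Y) q (0, 1) = fderiv ℝ (partialY Y) q (1, 0) := by
  have hd := hasFDerivAt_of_contDiffOn ((contDiffOn_infty_iff_fderiv_of_isOpen hW).1 hY).2 hW hq
  have h1 (u : ℝ × ℝ) : HasFDerivAt (fun q => fderiv ℝ Y q u)
      ((fderiv ℝ (fderiv ℝ Y) q).flip u) q := by
    simpa using hd.clm_apply (hasFDerivAt_const u q)
  have hs : IsSymmSndFDerivAt ℝ Y q :=
    (hY.contDiffAt (hW.mem_nhds hq)).isSymmSndFDerivAt (by
      rw [minSmoothness_of_isRCLikeNormedField]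
      exact WithTop.coe_le_coe.2 le_top)
  change fderiv ℝ (fun q => fderiv ℝ Y q (1, 0)) q (0, 1) =
    fderiv ℝ (fun q => fderiv ℝ Y q (0, 1)) q (1, 0)
  rw [(h1 _).fderiv, (h1 _).fderiv]
  exact hs.eq _ _

/-- In a normal parametrization of a `p`-minimal surface, `∂/∂x` depends on `y` only. -/
lemma IsNormalSurface.fderiv_partialX_one_zero (hW : IsOpen W) (hY : IsNormalSurface N W Y)
    {q : ℝ × ℝ} (hq : q ∈ W) : (fderiv ℝ (partialX Y) q (1, 0)).1 = 0 ∧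
      (fderiv ℝ (partialX Y) q (1, 0)).2.1 = 0 := by
  -- Here `e₁ = ∂_x`, and `J` only rotates its components, so `∇_{e₁} e₂ = 0` says that these have
  -- zero `x`-derivative.
  have h := hY.pMinimal W subset_rfl hW _ hY.normal.char q hq (1, 0) rfl
  have hd := hasFDerivAt_of_contDiffOn (contDiffOn_partialX hW hY.smooth) hW hq
  simp only [nabla, frameCoord_e2, Pi.zero_apply, neg_zero, zero_smul] at h
  have h' := congrArg (frameCoord (Y q)) h
  have hE : HasFDerivAt (fun q' => (-(partialX Y q').2.1, (partialX Y q').1, (0 : ℝ))) _ q :=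
    (hd.snd.fst.neg).prodMk (hd.fst.prodMk (hasFDerivAt_const (0 : ℝ) q))
  rw [frameCoord_ofFrame, hE.fderiv] at h'
  simp [frameCoord, Theta] at h'
  exact ⟨h'.2, h'.1⟩

/-- In a normal parametrization of a `p`-minimal surface, `∂/∂x` rotates at constant speed `ε`
in the `y`-direction. -/
lemma IsNormalSurface.fderiv_partialX (h : HasCoefficients N I D ε f g) (hI : IsOpen I)
    (hf : ContDiffOn ℝ ∞ f I) (hW : IsOpen W) (hWD : W ⊆ D) (hY : IsNormalSurface N W Y)
    {q : ℝ × ℝ} (hq : q ∈ W) (u : ℝ × ℝ) :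
    (fderiv ℝ (partialX Y) q u).1 = -(ε * (partialX Y q).2.1) * u.2 ∧
      (fderiv ℝ (partialX Y) q u).2.1 = ε * (partialX Y q).1 * u.2 := by
  obtain ⟨h1, h2⟩ := hY.fderiv_partialX_one_zero hW hq
  have hX := hasFDerivAt_of_contDiffOn (contDiffOn_partialX hW hY.smooth) hW hq
  have hYd := hasFDerivAt_of_contDiffOn (contDiffOn_partialY hW hY.smooth) hW hq
  have hfd : HasFDerivAt (fun q : ℝ × ℝ => f q.2)
      (deriv f q.2 • ContinuousLinearMap.snd ℝ ℝ ℝ) q := by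
    have : HasDerivAt f (deriv f q.2) q.2 := ((hf.differentiableOn (by simp)).differentiableAt
      (hI.mem_nhds (h.mem q (hWD hq)))).hasDerivAt
    exact this.comp_hasFDerivAt q hasFDerivAt_snd
  have hA : HasFDerivAt (coefA ε f) (ε • ContinuousLinearMap.fst ℝ ℝ ℝ +
      deriv f q.2 • ContinuousLinearMap.snd ℝ ℝ ℝ) q :=
    (hasFDerivAt_fst.const_mul ε).add hfd
  have hev : ∀ᶠ q' in 𝓝 q, FrameEquations (coefA ε f q') (coefB ε f g q') Y q' := by
    filter_upwards [hW.mem_nhds hq] with q' hq' using hY.normal.frameEquations h hWD hq'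
  -- The frame equations are differentiated in `x`: `∂_x` has no `x`-derivative, so only `A_x = ε`
  -- contributes. Symmetry of the mixed derivatives turns the result into the `y`-derivative of
  -- `∂_x`.
  have e1 : (fderiv ℝ (partialY Y) q (1, 0)).1 = -(ε * (partialX Y q).2.1) := by
    have := ((hA.mul hX.snd.fst).neg.congr_of_eventuallyEq
      (hev.mono fun q' h => h.fst)).unique hYd.fst
    have := congrArg (fun L => L (1, 0)) this
    simp [h2] at this
    linarith
  have e2 : (fderiv ℝ (partialY Y) q (1, 0)).2.1 = ε * (partialX Y q).1 := by
    have := ((hA.mul hX.fst).congr_of_eventuallyEq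
      (hev.mono fun q' h => h.snd)).unique hYd.snd.fst
    have := congrArg (fun L => L (1, 0)) this
    simp [h1] at this
    linarith
  have hu : fderiv ℝ (partialX Y) q u = u.1 • fderiv ℝ (partialX Y) q (1, 0) +
      u.2 • fderiv ℝ (partialX Y) q (0, 1) := by
    rw [← map_smul, ← map_smul, ← map_add]
    simp
  rw [hu, fderiv_partialX_eq_fderiv_partialY hW hY.smooth hq]
  constructor
  · simp only [Prod.fst_add, Prod.smul_fst, smul_eq_mul, e1, h1]
    ring
  · simp only [Prod.fst_add, Prod.smul_fst, Prod.snd_add, Prod.smul_snd, smul_eq_mul, e2, h2]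
    ring

/-- Two normal surfaces with the same normal form over a connected open set differ by a rigid
motion. -/
lemma IsNormalSurface.exists_eq_rigid (h : HasCoefficients N I D ε f g) (hI : IsOpen I)
    (hf : ContDiffOn ℝ ∞ f I) (hW : IsOpen W) (hWc : IsPreconnected W) (hWD : W ⊆ D)
    (hX : IsNormalSurface N W X) (hY : IsNormalSurface N W Y) (hne : W.Nonempty) :
    ∃ (k : ℝ × ℝ) (t : H1), k.1 ^ 2 + k.2 ^ 2 = 1 ∧ ∀ q ∈ W, Y q = rigid k t (X q) := by
  have hX1 {q} (hq : q ∈ W) :=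
    hasFDerivAt_of_contDiffOn (contDiffOn_partialX hW hX.smooth) hW hq
  have hY1 {q} (hq : q ∈ W) :=
    hasFDerivAt_of_contDiffOn (contDiffOn_partialX hW hY.smooth) hW hq
  have hX0 {q} (hq : q ∈ W) := hasFDerivAt_of_contDiffOn hX.smooth hW hq
  have hY0 {q} (hq : q ∈ W) := hasFDerivAt_of_contDiffOn hY.smooth hW hq
  have FX {q} (hq : q ∈ W) := hX.normal.frameEquations h hWD hq
  have FY {q} (hq : q ∈ W) := hY.normal.frameEquations h hWD hq
  -- As a complex number, `k` is the conjugate of the horizontal part of `X_x` times that of `Y_x`.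
  -- It is constant because both factors turn at the same speed `ε`.
  obtain ⟨k, hk⟩ : ∃ k : ℝ × ℝ, ∀ q ∈ W,
      ((partialX X q).1 * (partialX Y q).1 + (partialX X q).2.1 * (partialX Y q).2.1,
       (partialX X q).1 * (partialX Y q).2.1 - (partialX X q).2.1 * (partialX Y q).1) = k := by
    have hd {q} (hq : q ∈ W) :=
      (((hX1 hq).fst.mul (hY1 hq).fst).add ((hX1 hq).snd.fst.mul (hY1 hq).snd.fst)).prodMk
        (((hX1 hq).fst.mul (hY1 hq).snd.fst).sub ((hX1 hq).snd.fst.mul (hY1 hq).fst))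
    refine hW.exists_is_const_of_fderiv_eq_zero hWc
      (fun q hq => (hd hq).differentiableAt.differentiableWithinAt) fun q hq => ?_
    refine (hd hq).fderiv.trans (ContinuousLinearMap.ext fun u => ?_)
    have a := hX.fderiv_partialX h hI hf hW hWD hq u
    have b := hY.fderiv_partialX h hI hf hW hWD hq u
    refine Prod.ext ?_ ?_
    · simp [a.1, a.2, b.1, b.2]
      ring
    · simp [a.1, a.2, b.1, b.2]
      ring
  have hk1 : k.1 ^ 2 + k.2 ^ 2 = 1 := by
    obtain ⟨q, hq⟩ := hne
    rw [← hk q hq]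
    linear_combination ((partialX Y q).1 ^ 2 + (partialX Y q).2.1 ^ 2) * (FX hq).unit + (FY hq).unit
  have c1 {q} (hq : q ∈ W) :
      (partialX Y q).1 = k.1 * (partialX X q).1 - k.2 * (partialX X q).2.1 := by
    rw [← hk q hq]
    linear_combination -(partialX Y q).1 * (FX hq).unit
  have c2 {q} (hq : q ∈ W) :
      (partialX Y q).2.1 = k.2 * (partialX X q).1 + k.1 * (partialX X q).2.1 := by
    rw [← hk q hq]
    linear_combination -(partialX Y q).2.1 * (FX hq).unit
  have d1 {q} (hq : q ∈ W) (u : ℝ × ℝ) : (fderiv ℝ Y q u).1 =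
      k.1 * (fderiv ℝ X q u).1 - k.2 * (fderiv ℝ X q u).2.1 := by
    simp only [fderiv_apply_eq_partials, Prod.fst_add, Prod.smul_fst, Prod.snd_add, Prod.smul_snd,
      smul_eq_mul, (FX hq).fst, (FX hq).snd, (FY hq).fst, c1 hq, c2 hq]
    ring
  have d2 {q} (hq : q ∈ W) (u : ℝ × ℝ) : (fderiv ℝ Y q u).2.1 =
      k.2 * (fderiv ℝ X q u).1 + k.1 * (fderiv ℝ X q u).2.1 := by
    simp only [fderiv_apply_eq_partials, Prod.fst_add, Prod.smul_fst, Prod.snd_add, Prod.smul_snd,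
      smul_eq_mul, (FX hq).fst, (FX hq).snd, (FY hq).snd, c1 hq, c2 hq]
    ring
  -- The contact form pulls back to `B dy` under both maps.
  have d3 {q} (hq : q ∈ W) (u : ℝ × ℝ) :
      Theta (Y q) (fderiv ℝ Y q u) = Theta (X q) (fderiv ℝ X q u) := by
    have a := (FX hq).contact
    have b := (FX hq).Theta
    have c := (FY hq).contact
    have d := (FY hq).Theta
    simp only [fderiv_apply_eq_partials (Y := X), fderiv_apply_eq_partials (Y := Y), Theta, Prod.fst_add,
      Prod.smul_fst, Prod.snd_add, Prod.smul_snd, smul_eq_mul] at a b c d ⊢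
    linear_combination u.1 * (c - a) + u.2 * (d - b)
  obtain ⟨t, ht⟩ : ∃ t : ℝ × ℝ, ∀ q ∈ W,
      ((Y q).1 - (k.1 * (X q).1 - k.2 * (X q).2.1),
       (Y q).2.1 - (k.2 * (X q).1 + k.1 * (X q).2.1)) = t := by
    have hd {q} (hq : q ∈ W) :=
      ((hY0 hq).fst.sub (((hX0 hq).fst.const_mul k.1).sub
        ((hX0 hq).snd.fst.const_mul k.2))).prodMk
      ((hY0 hq).snd.fst.sub (((hX0 hq).fst.const_mul k.2).add
        ((hX0 hq).snd.fst.const_mul k.1)))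
    refine hW.exists_is_const_of_fderiv_eq_zero hWc
      (fun q hq => (hd hq).differentiableAt.differentiableWithinAt) fun q hq => ?_
    refine (hd hq).fderiv.trans (ContinuousLinearMap.ext fun u => ?_)
    refine Prod.ext ?_ ?_
    · simp [d1 hq u]
    · simp [d2 hq u]
  have t1 {q} (hq : q ∈ W) : (Y q).1 = t.1 + (k.1 * (X q).1 - k.2 * (X q).2.1) := by
    rw [← ht q hq]; ring
  have t2 {q} (hq : q ∈ W) : (Y q).2.1 = t.2 + (k.2 * (X q).1 + k.1 * (X q).2.1) := by
    rw [← ht q hq]; ring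
  obtain ⟨t', ht'⟩ : ∃ t' : ℝ, ∀ q ∈ W, (Y q).2.2 - ((X q).2.2 -
      t.1 * (k.2 * (X q).1 + k.1 * (X q).2.1) + t.2 * (k.1 * (X q).1 - k.2 * (X q).2.1)) = t' := by
    have hd {q} (hq : q ∈ W) :=
      (hY0 hq).snd.snd.sub (((hX0 hq).snd.snd.sub ((((hX0 hq).fst.const_mul k.2).add
        ((hX0 hq).snd.fst.const_mul k.1)).const_mul t.1)).add
        ((((hX0 hq).fst.const_mul k.1).sub ((hX0 hq).snd.fst.const_mul k.2)).const_mul t.2))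
    refine hW.exists_is_const_of_fderiv_eq_zero hWc
      (fun q hq => (hd hq).differentiableAt.differentiableWithinAt) fun q hq => ?_
    refine (hd hq).fderiv.trans (ContinuousLinearMap.ext fun u => ?_)
    have := d3 hq u
    simp only [Theta, d1 hq u, d2 hq u, t1 hq, t2 hq] at this
    simp
    -- The factor of `hk1` reflects the rotation invariance of `x dy - y dx`.
    linear_combination this + ((X q).2.1 * (fderiv ℝ X q u).1 - (X q).1 * (fderiv ℝ X q u).2.1) * hk1
  refine ⟨k, (t.1, t.2, t'), hk1, fun q hq => ?_⟩
  rw [rigid_apply]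
  refine Prod.ext (t1 hq) (Prod.ext (t2 hq) ?_)
  rw [← ht' q hq]
  simp only
  ring

/-- A rigid motion is determined by its values on an open piece of a normal surface. -/
lemma rigid_unique (h : HasCoefficients N I D ε f g) (hX : IsNormalSurface N D X) (hW : IsOpen W)
    (hWD : W ⊆ D) (hne : W.Nonempty) {k k' : ℝ × ℝ} {t t' : H1}
    (e : ∀ q ∈ W, rigid k t (X q) = rigid k' t' (X q)) : k = k' ∧ t = t' := by
  obtain ⟨q, hq⟩ := hne
  have hXW := hX.mono hWD
  have hd := hasFDerivAt_of_contDiffOn hXW.smooth hW hq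
  have F := hXW.normal.frameEquations h hWD hq
  have E := ((hasFDerivAt_rigid k t (X q)).comp q hd).unique
    (((hasFDerivAt_rigid k' t' (X q)).comp q hd).congr_of_eventuallyEq
      (by filter_upwards [hW.mem_nhds hq] with q' hq' using e q' hq'))
  have E' : rigidLinear k t (partialX X q) = rigidLinear k' t' (partialX X q) :=
    congrArg (fun L => L (1, 0)) E
  rw [rigidLinear_apply, rigidLinear_apply, Prod.mk.injEq, Prod.mk.injEq] at E'
  obtain ⟨e1, e2, -⟩ := E'
  -- The linear parts agree on `∂_x`, and a planar rotation is determined by the image of one unit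
  -- vector.
  have hk : k = k' := by
    refine Prod.ext ?_ ?_
    · linear_combination (k'.1 - k.1) * F.unit + (partialX X q).1 * e1 + (partialX X q).2.1 * e2
    · linear_combination (k'.2 - k.2) * F.unit + (partialX X q).1 * e2 - (partialX X q).2.1 * e1
  subst hk
  have := e q hq
  rw [rigid_apply, rigid_apply, Prod.mk.injEq, Prod.mk.injEq] at this
  obtain ⟨a, b, c⟩ := this
  have a' : t.1 = t'.1 := by linarith
  have b' : t.2.1 = t'.2.1 := by linarith
  rw [a', b'] at c
  exact ⟨rfl, Prod.ext a' (Prod.ext b' (by linarith))⟩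

/-- Local congruence over a connected space is global. -/
lemma exists_isRigidMotion_of_locally {S : Type*} [TopologicalSpace S] [PreconnectedSpace S]
    (h : HasCoefficients N I D ε f g) (hX : IsNormalSurface N D X) {F : S → H1} {φ : S → ℝ × ℝ}
    (hφ : IsOpenMap φ) (hφD : ∀ p, φ p ∈ D)
    (hloc : ∀ p, ∃ (k : ℝ × ℝ) (t : H1), k.1 ^ 2 + k.2 ^ 2 = 1 ∧
      ∀ᶠ p' in 𝓝 p, F p' = rigid k t (X (φ p'))) :
    ∃ Φ, IsRigidMotion Φ ∧ ∀ p, F p = Φ (X (φ p)) := by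
  rcases isEmpty_or_nonempty S with hS | ⟨⟨p₀⟩⟩
  · exact ⟨rigid (1, 0) 0, isRigidMotion_rigid (by norm_num) 0, fun p => (hS.false p).elim⟩
  obtain ⟨k, t, hk, h₀⟩ := hloc p₀
  refine ⟨rigid k t, isRigidMotion_rigid hk t, ?_⟩
  -- For closedness, a limit point `p` has its own motion `k', t'` nearby. Some `p₁` close to `p`
  -- lies in the set and in the range of validity of that motion, so the two motions agree on the
  -- image of an open set under `X ∘ φ` and coincide.
  have hcl : IsClopen {p | ∀ᶠ p' in 𝓝 p, F p' = rigid k t (X (φ p'))} := by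
    refine ⟨isClosed_iff_frequently.2 fun p hp => ?_, isOpen_setOfPred_eventually_nhds⟩
    obtain ⟨k', t', -, h'⟩ := hloc p
    obtain ⟨p₁, h1, h2⟩ := (hp.and_eventually h'.eventually_nhds).exists
    obtain ⟨V, hV, hVo, hpV⟩ := eventually_nhds_iff.1 (h1.and h2)
    obtain ⟨rfl, rfl⟩ := rigid_unique (k := k) (k' := k') (t := t) (t' := t') h hX (hφ V hVo)
      (by rintro _ ⟨p, -, rfl⟩; exact hφD p) ⟨_, p₁, hpV, rfl⟩ (by
        rintro _ ⟨p, hp, rfl⟩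
        rw [← (hV p hp).1, ← (hV p hp).2])
    exact h'
  intro p
  have : p ∈ {p | ∀ᶠ p' in 𝓝 p, F p' = rigid k t (X (φ p'))} := by
    rw [hcl.eq_univ ⟨p₀, h₀⟩]; trivial
  exact this.self_of_nhds

/-- Uniqueness of the surface over a connected domain. -/
lemma IsNormalSurface.unique (h : HasCoefficients N I D ε f g) (hI : IsOpen I)
    (hf : ContDiffOn ℝ ∞ f I) (hD : IsOpen D) (hDc : IsPreconnected D)
    (hX : IsNormalSurface N D X) (hY : IsNormalSurface N D Y) :
    ∃ Φ, IsRigidMotion Φ ∧ ∀ q ∈ D, Y q = Φ (X q) := by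
  rcases D.eq_empty_or_nonempty with rfl | hne
  · exact ⟨rigid (1, 0) 0, isRigidMotion_rigid (by norm_num) 0, fun p hp => hp.elim⟩
  obtain ⟨k, t, hk, e⟩ := hX.exists_eq_rigid h hI hf hD hDc subset_rfl hY hne
  exact ⟨_, isRigidMotion_rigid hk t, e⟩

/-! ### Surfaces immersed from an abstract 2-manifold -/

section Manifold

variable {M : Type*} [TopologicalSpace M] [ChartedSpace (ℝ × ℝ) M]

lemma exists_isRigidMotion_of_normalCoordinates [ConnectedSpace M]
    (h : HasCoefficients N I D ε f g) (hI : IsOpen I) (hf : ContDiffOn ℝ ∞ f I) (hD : IsOpen D)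
    (hX : IsNormalSurface N D X) {F : M → H1} {φ : M → ℝ × ℝ} (hF : IsPMinimalSurface F)
    (hφ : IsNormalCoordinates N F φ) (hφD : ∀ p, φ p ∈ D) :
    ∃ Φ, IsRigidMotion Φ ∧ ∀ p, F p = Φ (X (φ p)) := by
  refine exists_isRigidMotion_of_locally h hX hφ.localDiffeo.isOpenMap hφD fun p => ?_
  have hp := hφ.localDiffeo p
  have hmem : φ p ∈ hp.localInverse.source ∩ D := ⟨hp.localInverse_mem_source, hφD p⟩
  -- A ball serves as parameter domain because local congruence needs connectedness.
  obtain ⟨r, hr, hb⟩ := Metric.isOpen_iff.1 (hp.localInverse_open_source.inter hD) _ hmem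
  set W := Metric.ball (φ p) r
  have hWo : IsOpen W := Metric.isOpen_ball
  set σ : ℝ × ℝ → M := hp.localInverse.toFun
  have hσ : IsLocalParam W σ := by
    refine ⟨hWo, fun q => ⟨hp.localInverse, (hb q.2).1, fun _ _ => rfl⟩⟩
  have hφσ : ∀ q ∈ W, φ (σ q) = q := fun q hq => hp.localInverse_right_inv (hb hq).1
  have hN := hφ.normal W σ hσ hφσ
  have hsm : ContDiffOn ℝ ∞ (F ∘ σ) W :=
    (hF.smooth.comp_contMDiffOn hσ.2.contMDiffOn).contDiffOn
  have hWD : W ⊆ D := fun q hq => (hb hq).2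
  have hFσ : IsNormalSurface N W (F ∘ σ) :=
    { smooth := hsm
      immersion := fun q hq =>
        (hN.frameEquations h hWD hq).injective (h.pos q (hWD hq)).ne'
      pMinimal := hF.pMinimal W σ hσ
      normal := hN }
  obtain ⟨k, t, hk, e⟩ := (hX.mono hWD).exists_eq_rigid h hI hf hWo
    (convex_ball _ _).isPreconnected hWD hFσ ⟨φ p, Metric.mem_ball_self hr⟩
  refine ⟨k, t, hk, ?_⟩
  have hφc : ContinuousAt φ p := hφ.localDiffeo.contMDiff.continuous.continuousAt
  filter_upwards [hφc (Metric.ball_mem_nhds _ hr), hp.localInverse_eventuallyEq_left]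
    with p' h1 h2
  rw [← e _ h1]
  exact congrArg F h2.symm

end Manifold

/-! ### Existence -/

/-- A smooth function on an open interval has a smooth primitive. -/
lemma exists_contDiffOn_primitive (hI : IsOpen I) (hIc : I.OrdConnected) {h : ℝ → ℝ}
    (hh : ContDiffOn ℝ ∞ h I) :
    ∃ H : ℝ → ℝ, ContDiffOn ℝ ∞ H I ∧ ∀ y ∈ I, HasDerivAt H (h y) y := by
  rcases I.eq_empty_or_nonempty with rfl | ⟨a, ha⟩
  · exact ⟨0, contDiffOn_const, fun y hy => hy.elim⟩
  have hd : ∀ y ∈ I, HasDerivAt (fun y => ∫ t in a..y, h t) (h y) y := fun y hy =>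
    intervalIntegral.integral_hasDerivAt_right
      ((hh.continuousOn.mono (hIc.uIcc_subset ha hy)).intervalIntegrable)
      (hh.continuousOn.stronglyMeasurableAtFilter hI _ hy)
      (hh.continuousOn.continuousAt (hI.mem_nhds hy))
  refine ⟨_, (contDiffOn_infty_iff_deriv_of_isOpen hI).2
    ⟨fun y hy => (hd y hy).differentiableAt.differentiableWithinAt, ?_⟩, hd⟩
  exact hh.congr fun y hy => (hd y hy).deriv

/-- A parametrization satisfying the frame equations is `p`-minimal if the direction of `∂/∂x`
depends on `y` only. -/
lemma isPMinimalOn_of_frameEquations {A B : ℝ × ℝ → ℝ} (hB : ∀ q ∈ D, B q ≠ 0)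
    (hF : ∀ q ∈ D, FrameEquations (A q) (B q) X q) {c s : ℝ → ℝ} (hc : Differentiable ℝ c)
    (hs : Differentiable ℝ s) (hXc : ∀ q ∈ D, (partialX X q).1 = c q.2)
    (hXs : ∀ q ∈ D, (partialX X q).2.1 = s q.2) : IsPMinimalOn X D := by
  intro V hVD hV e₁ he q hq u hu
  have hcs {q} (hq : q ∈ V) : c q.2 ^ 2 + s q.2 ^ 2 = 1 := by
    rw [← hXc q (hVD hq), ← hXs q (hVD hq)]
    exact (hF q (hVD hq)).unit
  -- Any characteristic field is `± ∂_x`, since tangent vectors killed by the contact form have no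
  -- `∂_y` part; `l` is the sign.
  set l : ℝ × ℝ → ℝ := fun q => (e₁ q).1 * c q.2 + (e₁ q).2.1 * s q.2 with hl
  have hdir {q u : ℝ × ℝ} (hq : q ∈ V) (hu : fderiv ℝ X q u = e₁ q) :
      u.2 = 0 ∧ (e₁ q).1 = l q * c q.2 ∧ (e₁ q).2.1 = l q * s q.2 ∧ l q ^ 2 = 1 := by
    have h1 := he.contact q hq
    have h2 := he.unit q hq
    have F := hF q (hVD hq)
    change Theta _ _ = 0 at h1
    rw [metric, h1] at h2
    have hu2 : u.2 = 0 := by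
      have a := F.contact
      have b := F.Theta
      rw [← hu] at h1
      simp only [Theta, fderiv_apply_eq_partials, Prod.fst_add, Prod.smul_fst, Prod.snd_add,
        Prod.smul_snd, smul_eq_mul] at h1 a b
      have : u.2 * B q = 0 := by linear_combination h1 - u.1 * a - u.2 * b
      exact (mul_eq_zero.1 this).resolve_right (hB q (hVD hq))
    have e1 : (e₁ q).1 = u.1 * c q.2 := by
      rw [← hu, fderiv_apply_eq_partials, hu2, ← hXc q (hVD hq)]
      simp
    have e2 : (e₁ q).2.1 = u.1 * s q.2 := by
      rw [← hu, fderiv_apply_eq_partials, hu2, ← hXs q (hVD hq)]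
      simp
    have hlu : l q = u.1 := by
      simp only [hl, e1, e2]
      linear_combination u.1 * hcs hq
    refine ⟨hu2, by rw [hlu, e1], by rw [hlu, e2], ?_⟩
    rw [e1, e2] at h2
    rw [hlu]
    linear_combination h2 - u.1 ^ 2 * hcs hq
  have hlc : ContinuousAt l q := by
    have h := he.smooth.continuousOn.continuousAt (hV.mem_nhds hq)
    exact (h.fst.mul (hc.continuous.continuousAt.comp continuousAt_snd)).add
      (h.snd.fst.mul (hs.continuous.continuousAt.comp continuousAt_snd))
  -- The values `1` and `-1` are at distance 2, so by continuity the sign is locally constant.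
  have hlq : ∀ᶠ q' in 𝓝 q, l q' = l q := by
    filter_upwards [hV.mem_nhds hq, hlc (Metric.ball_mem_nhds (l q) one_pos)] with q' h1 h2
    obtain ⟨u', hu'⟩ := he.tangent q' h1
    have a := (hdir h1 hu').2.2.2
    have b := (hdir hq hu).2.2.2
    rw [mem_preimage, Metric.mem_ball, Real.dist_eq, abs_lt] at h2
    have hm : (l q' - l q) * (l q' + l q) = 0 := by linear_combination a - b
    refine (mul_eq_zero.1 hm).elim sub_eq_zero.1 fun h0 => ?_
    nlinarith
  -- Near `q` the components of `e₂` depend on `y` only, while `e₁` points in the `x`-direction;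
  -- hence `∇_{e₁} e₂ = 0`.
  have hev : (fun q' => frameCoord (X q') (e2 X e₁ q')) =ᶠ[𝓝 q]
      fun q' => (-(l q * s q'.2), l q * c q'.2, (0 : ℝ)) := by
    filter_upwards [hV.mem_nhds hq, hlq] with q' h1 h2
    obtain ⟨u', hu'⟩ := he.tangent q' h1
    obtain ⟨-, e1, e2, -⟩ := hdir h1 hu'
    rw [frameCoord_e2, e1, e2, h2]
  have sd : HasFDerivAt (Prod.snd : ℝ × ℝ → ℝ) (ContinuousLinearMap.snd ℝ ℝ ℝ) q :=
    hasFDerivAt_snd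
  have hE : HasFDerivAt (fun q' : ℝ × ℝ => (-(l q * s q'.2), l q * c q'.2, (0 : ℝ))) _ q :=
    ((((hs q.2).hasDerivAt.comp_hasFDerivAt q sd).const_mul (l q)).neg).prodMk
      ((((hc q.2).hasDerivAt.comp_hasFDerivAt q sd).const_mul (l q)).prodMk
        (hasFDerivAt_const (0 : ℝ) q))
  rw [nabla, hev.fderiv_eq, hE.fderiv]
  simp [(hdir hq hu).1, ofFrame]

/-- The curve `(U, V, Z)` is the trace of the surface at `x = 0`. There the frame equations read `U'
= -f s`, `V' = f c` and `Z' + U V' - V U' = g`, which are solved by successive primitives on `I`.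
The slope of `z` in `x` is forced by `∂_x` being horizontal. -/
lemma exists_isNormalSurface (h : HasCoefficients N I D ε f g) (hI : IsOpen I)
    (hIc : I.OrdConnected) (hf : ContDiffOn ℝ ∞ f I) (hg : ContDiffOn ℝ ∞ g I) (hD : IsOpen D) :
    ∃ X, IsNormalSurface N D X := by
  set c : ℝ → ℝ := fun y => Real.cos (ε * y)
  set s : ℝ → ℝ := fun y => Real.sin (ε * y)
  have hcd (y : ℝ) : HasDerivAt c (-(s y) * ε) y := by
    simpa using ((hasDerivAt_id y).const_mul ε).cos
  have hsd (y : ℝ) : HasDerivAt s (c y * ε) y := by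
    simpa using ((hasDerivAt_id y).const_mul ε).sin
  have hcs (y : ℝ) : c y ^ 2 + s y ^ 2 = 1 := Real.cos_sq_add_sin_sq _
  have hc : ContDiff ℝ ∞ c := Real.contDiff_cos.comp (contDiff_const.mul contDiff_id)
  have hs : ContDiff ℝ ∞ s := Real.contDiff_sin.comp (contDiff_const.mul contDiff_id)
  obtain ⟨U, hU, hUd⟩ := exists_contDiffOn_primitive hI hIc (hf.mul hs.contDiffOn).neg
  obtain ⟨V, hV, hVd⟩ := exists_contDiffOn_primitive hI hIc (hf.mul hc.contDiffOn)
  obtain ⟨Z, hZ, hZd⟩ := exists_contDiffOn_primitive hI hIc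
    (hg.sub (hf.mul ((hU.mul hc.contDiffOn).add (hV.mul hs.contDiffOn))))
  set X : ℝ × ℝ → H1 := fun q => (c q.2 * q.1 + U q.2, s q.2 * q.1 + V q.2,
    (V q.2 * c q.2 - U q.2 * s q.2) * q.1 + Z q.2)
  have hmap : MapsTo (Prod.snd : ℝ × ℝ → ℝ) D I := h.mem
  have hsnd : ContDiffOn ℝ ∞ (Prod.snd : ℝ × ℝ → ℝ) D := contDiffOn_snd
  have hfst : ContDiffOn ℝ ∞ (Prod.fst : ℝ × ℝ → ℝ) D := contDiffOn_fst
  have hc' := hc.comp_contDiffOn hsnd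
  have hs' := hs.comp_contDiffOn hsnd
  have hU' := hU.comp hsnd hmap
  have hV' := hV.comp hsnd hmap
  have hXs : ContDiffOn ℝ ∞ X D :=
    ((hc'.mul hfst).add hU').prodMk (((hs'.mul hfst).add hV').prodMk
      ((((hV'.mul hc').sub (hU'.mul hs')).mul hfst).add (hZ.comp hsnd hmap)))
  have hXd (q) (hq : q ∈ D) : partialX X q = (c q.2, s q.2, V q.2 * c q.2 - U q.2 * s q.2) ∧
      partialY X q = (-(s q.2 * ε) * q.1 - f q.2 * s q.2, c q.2 * ε * q.1 + f q.2 * c q.2,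
        (f q.2 - ε * (U q.2 * c q.2 + V q.2 * s q.2)) * q.1 +
          (g q.2 - f q.2 * (U q.2 * c q.2 + V q.2 * s q.2))) := by
    have sd : HasFDerivAt (Prod.snd : ℝ × ℝ → ℝ) (ContinuousLinearMap.snd ℝ ℝ ℝ) q :=
      hasFDerivAt_snd
    have fd : HasFDerivAt (Prod.fst : ℝ × ℝ → ℝ) (ContinuousLinearMap.fst ℝ ℝ ℝ) q :=
      hasFDerivAt_fst
    have c1 := (hcd q.2).comp_hasFDerivAt q sd
    have s1 := (hsd q.2).comp_hasFDerivAt q sd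
    have U1 := (hUd q.2 (h.mem q hq)).comp_hasFDerivAt q sd
    have V1 := (hVd q.2 (h.mem q hq)).comp_hasFDerivAt q sd
    have Z1 := (hZd q.2 (h.mem q hq)).comp_hasFDerivAt q sd
    have hE : HasFDerivAt X _ q :=
      ((c1.mul fd).add U1).prodMk (((s1.mul fd).add V1).prodMk
        ((((V1.mul c1).sub (U1.mul s1)).mul fd).add Z1))
    rw [partialX, partialY, hE.fderiv]
    constructor
    · simp
    · simp
      refine ⟨by ring, by ring, ?_⟩
      linear_combination f q.2 * q.1 * hcs q.2
  have hF (q) (hq : q ∈ D) : FrameEquations (coefA ε f q) (coefB ε f g q) X q := by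
    obtain ⟨e1, e2⟩ := hXd q hq
    have e0 : X q = (c q.2 * q.1 + U q.2, s q.2 * q.1 + V q.2,
      (V q.2 * c q.2 - U q.2 * s q.2) * q.1 + Z q.2) := rfl
    refine ⟨?_, ?_, ?_, ?_, ?_⟩ <;> simp only [e0, e1, e2, Theta, coefA, coefB]
    · exact hcs _
    · ring
    · ring
    · ring
    · linear_combination (q.1 * (ε * q.1 + f q.2)) * hcs q.2
  exact ⟨X, hXs, fun q hq => (hF q hq).injective (h.pos q hq).ne',
    isPMinimalOn_of_frameEquations (fun q hq => (h.pos q hq).ne') hF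
      (fun y => (hcd y).differentiableAt) (fun y => (hsd y).differentiableAt)
      (fun q hq => by rw [(hXd q hq).1]) (fun q hq => by rw [(hXd q hq).1]),
    h.isNormalParam hD hXs hF⟩

/-! ### Domains -/

/-- The region of points `(m(y) + s r(y), y)` with `y ∈ I` and `s ∈ K` is connected. -/
lemma isPreconnected_of_mem_iff (hIc : I.OrdConnected) {K : Set ℝ} (hK : K.OrdConnected)
    {m r : ℝ → ℝ} (hm : ContinuousOn m I) (hr : ContinuousOn r I)
    (hD : ∀ q : ℝ × ℝ, q ∈ D ↔ q.2 ∈ I ∧ ∃ s ∈ K, q.1 = m q.2 + s * r q.2) :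
    IsPreconnected D := by
  have h2 : MapsTo (Prod.snd : ℝ × ℝ → ℝ) (K ×ˢ I) I := fun p hp => hp.2
  have := (hK.isPreconnected.prod hIc.isPreconnected).image
    (fun p : ℝ × ℝ => (m p.2 + p.1 * r p.2, p.2)) (((hm.comp continuousOn_snd h2).add
    (continuousOn_fst.mul (hr.comp continuousOn_snd h2))).prodMk continuousOn_snd)
  convert this using 1
  ext q
  rw [hD]
  constructor
  · rintro ⟨h, s, hs, e⟩
    exact ⟨(s, q.2), ⟨hs, h⟩, Prod.ext e.symm rfl⟩
  · rintro ⟨p, ⟨h1, h2⟩, rfl⟩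
    exact ⟨h2, p.1, h1, rfl⟩

/-- A subset of the strip over `I` cut out by a continuous inequality is open. -/
lemma isOpen_strip_lt (hI : IsOpen I) {u v : ℝ × ℝ → ℝ}
    (hu : ContinuousOn u {q | q.2 ∈ I}) (hv : ContinuousOn v {q | q.2 ∈ I}) :
    IsOpen {q : ℝ × ℝ | q.2 ∈ I ∧ u q < v q} := by
  have hO : IsOpen {q : ℝ × ℝ | q.2 ∈ I} := hI.preimage continuous_snd
  have := (hv.sub hu).isOpen_inter_preimage hO isOpen_Ioi (t := Ioi 0)
  convert this using 1
  ext q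
  simp

/-- A nowhere vanishing continuous function on a connected set has constant sign. -/
lemma pos_or_neg_of_isPreconnected {S : Type*} [TopologicalSpace S] {s : Set S}
    (hs : IsPreconnected s) {u : S → ℝ} (hu : ContinuousOn u s) (h0 : ∀ p ∈ s, u p ≠ 0) :
    (∀ p ∈ s, 0 < u p) ∨ ∀ p ∈ s, u p < 0 := by
  by_contra! H
  obtain ⟨⟨p, hp, hp'⟩, p', hq, hq'⟩ := H
  obtain ⟨x, hx, hx'⟩ := hs.intermediate_value hp hq hu ⟨hp', hq'⟩
  exact h0 x hx hx'

/-! ### The eight surfaces -/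

/-- A connected open domain on which the normal form `N` has smooth polynomial coefficients. -/
structure IsNormalDomain (N : NormalForm) (I : Set ℝ) (D : Set (ℝ × ℝ)) : Prop where
  isOpen : IsOpen D
  isPreconnected : IsPreconnected D
  coefficients : ∃ (ε : ℝ) (f g : ℝ → ℝ), ContDiffOn ℝ ∞ f I ∧ ContDiffOn ℝ ∞ g I ∧
    HasCoefficients N I D ε f g

lemma IsNormalDomain.isWellDefinedSurface (h : IsNormalDomain N I D) (hI : IsOpen I)
    (hIc : I.OrdConnected) : IsWellDefinedSurface N D := by
  obtain ⟨ε, f, g, hf, hg, hc⟩ := h.coefficients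
  exact ⟨exists_isNormalSurface hc hI hIc hf hg h.isOpen,
    fun X X' hX hX' => hX.unique hc hI hf h.isOpen h.isPreconnected hX'⟩

lemma IsNormalDomain.isPartOf {M : Type*} [TopologicalSpace M] [ChartedSpace (ℝ × ℝ) M]
    [ConnectedSpace M] (h : IsNormalDomain N I D) (hI : IsOpen I) (hIc : I.OrdConnected)
    {F : M → H1} {φ : M → ℝ × ℝ} (hF : IsPMinimalSurface F) (hφ : IsNormalCoordinates N F φ)
    (hφD : ∀ p, φ p ∈ D) : IsPartOf F φ N D := by
  obtain ⟨ε, f, g, hf, hg, hc⟩ := h.coefficients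
  exact ⟨hφD, exists_isNormalSurface hc hI hIc hf hg h.isOpen, fun X hX =>
    exists_isRigidMotion_of_normalCoordinates hc hI hf h.isOpen hX hF hφ hφD⟩

/-! ### Coefficients of the three normal forms -/

lemma sqrt_one_add_sq_ne_zero (a : ℝ) : √(1 + a ^ 2) ≠ 0 :=
  (Real.sqrt_pos.2 (by positivity)).ne'

lemma abs_eq_one_of_sq_eq_one {σ : ℝ} (hσ : σ ^ 2 = 1) : |σ| = 1 := by
  rw [← Real.sqrt_sq_eq_abs, hσ, Real.sqrt_one]

/-- With `w = x + ζ₁`, the prescribed `b` gives `1 / B = α² = 1 / w²`, hence `B = w²` and `A = α B =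
w`. -/
lemma hasCoefficients_specialI (hD : ∀ q ∈ D, q.2 ∈ I ∧ q.1 + ζ₁ q.2 ≠ 0) :
    HasCoefficients (specialI ζ₁) I D 1 ζ₁ (fun y => ζ₁ y ^ 2) := by
  have hB (q : ℝ × ℝ) : coefB 1 ζ₁ (fun y => ζ₁ y ^ 2) q = (q.1 + ζ₁ q.2) ^ 2 := by
    rw [coefB]; ring
  refine ⟨fun q hq => (hD q hq).1, fun q hq => ?_, fun q hq => ?_, fun q hq => ?_⟩ <;> rw [hB]
  · have := (hD q hq).2
    positivity
  · have := (hD q hq).2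
    simp only [specialI, coefA]
    field_simp
  · simp only [specialI]
    rw [div_mul_cancel₀ _ (sqrt_one_add_sq_ne_zero _), one_div_pow]

/-- Here `1 / B = |α|`, so `B = |2x + ζ₁|` and `A = α B` is the sign `σ` of `2x + ζ₁`; the direction
does not turn. -/
lemma hasCoefficients_specialII {σ : ℝ} (hσ : σ ^ 2 = 1)
    (hD : ∀ q ∈ D, q.2 ∈ I ∧ 0 < σ * (2 * q.1 + ζ₁ q.2)) :
    HasCoefficients (specialII ζ₁) I D 0 (fun _ => σ) (fun y => σ * ζ₁ y) := by
  have hB (q : ℝ × ℝ) : coefB 0 (fun _ => σ) (fun y => σ * ζ₁ y) q = σ * (2 * q.1 + ζ₁ q.2) := by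
    rw [coefB]; ring
  refine ⟨fun q hq => (hD q hq).1, fun q hq => ?_, fun q hq => ?_, fun q hq => ?_⟩ <;> rw [hB]
  · exact (hD q hq).2
  · have h0 := (hD q hq).2.ne'
    have hσ0 := left_ne_zero_of_mul h0
    have hw := right_ne_zero_of_mul h0
    simp only [specialII, coefA]
    field_simp
    ring
  · simp only [specialII]
    rw [div_mul_cancel₀ _ (sqrt_one_add_sq_ne_zero _), abs_div, abs_one]
    congr 1
    rw [← abs_of_pos (hD q hq).2, abs_mul, abs_eq_one_of_sq_eq_one hσ, one_mul]

/-- With `w = x + ζ₁` and `m = w² + ζ₂`, one finds `B = |m|` and `A = ε w`, where `ε` is the sign of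
`m`: positive for types I and II, negative for type III. -/
lemma hasCoefficients_general {ε : ℝ} (hε : ε ^ 2 = 1)
    (hD : ∀ q ∈ D, q.2 ∈ I ∧ 0 < ε * ((q.1 + ζ₁ q.2) ^ 2 + ζ₂ q.2)) :
    HasCoefficients (general ζ₁ ζ₂) I D ε (fun y => ε * ζ₁ y)
      (fun y => ε * (ζ₁ y ^ 2 + ζ₂ y)) := by
  have hB (q : ℝ × ℝ) : coefB ε (fun y => ε * ζ₁ y) (fun y => ε * (ζ₁ y ^ 2 + ζ₂ y)) q =
      ε * ((q.1 + ζ₁ q.2) ^ 2 + ζ₂ q.2) := by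
    rw [coefB]; ring
  refine ⟨fun q hq => (hD q hq).1, fun q hq => ?_, fun q hq => ?_, fun q hq => ?_⟩ <;> rw [hB]
  · exact (hD q hq).2
  · have h0 := (hD q hq).2.ne'
    have hε0 := left_ne_zero_of_mul h0
    simp only [general, coefA]
    rw [← mul_add, mul_div_mul_left _ _ hε0]
  · have h0 := (hD q hq).2
    have hm := right_ne_zero_of_mul h0.ne'
    have habs : |(q.1 + ζ₁ q.2) ^ 2 + ζ₂ q.2| = ε * ((q.1 + ζ₁ q.2) ^ 2 + ζ₂ q.2) := by
      rw [← abs_of_pos h0, abs_mul, abs_eq_one_of_sq_eq_one hε, one_mul]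
    rw [← habs]
    simp only [general]
    set w := q.1 + ζ₁ q.2
    set m := w ^ 2 + ζ₂ q.2
    have e : 1 + (w / m) ^ 2 = (w ^ 2 + m ^ 2) / m ^ 2 := by
      field_simp
      ring
    have hr : √(w ^ 2 + m ^ 2) ≠ 0 := (Real.sqrt_pos.2 (by positivity)).ne'
    rw [e, Real.sqrt_div (by positivity), Real.sqrt_sq_eq_abs]
    field_simp

/-! ### Openness and connectedness of the eight domains -/

lemma continuousOn_comp_snd {h : ℝ → ℝ} (hh : ContinuousOn h I) :
    ContinuousOn (fun q : ℝ × ℝ => h q.2) {q | q.2 ∈ I} :=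
  hh.comp continuousOn_snd fun _ hq => hq

lemma isNormalDomain_UIminus (hI : IsOpen I) (hIc : I.OrdConnected)
    (hζ₁ : ContDiffOn ℝ ∞ ζ₁ I) : IsNormalDomain (specialI ζ₁) I (UIminus I ζ₁) where
  isOpen := isOpen_strip_lt hI (continuousOn_fst.add (continuousOn_comp_snd hζ₁.continuousOn))
    continuousOn_const
  isPreconnected := isPreconnected_of_mem_iff hIc (ordConnected_Iio (a := 0))
    hζ₁.continuousOn.neg (continuousOn_const (c := 1)) fun q => and_congr_right fun _ =>
      ⟨fun h => ⟨q.1 + ζ₁ q.2, h, by simp⟩, fun ⟨s, hs, e⟩ => by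
        rw [mem_Iio] at hs
        simp only [Pi.neg_apply] at e
        linarith⟩
  coefficients := ⟨_, _, _, hζ₁, hζ₁.pow 2, hasCoefficients_specialI fun _ hq => ⟨hq.1, hq.2.ne⟩⟩

lemma isNormalDomain_UIplus (hI : IsOpen I) (hIc : I.OrdConnected)
    (hζ₁ : ContDiffOn ℝ ∞ ζ₁ I) : IsNormalDomain (specialI ζ₁) I (UIplus I ζ₁) where
  isOpen := isOpen_strip_lt hI continuousOn_const
    (continuousOn_fst.add (continuousOn_comp_snd hζ₁.continuousOn))
  isPreconnected := isPreconnected_of_mem_iff hIc (ordConnected_Ioi (a := 0))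
    hζ₁.continuousOn.neg (continuousOn_const (c := 1)) fun q => and_congr_right fun _ =>
      ⟨fun h => ⟨q.1 + ζ₁ q.2, h, by simp⟩, fun ⟨s, hs, e⟩ => by
        rw [mem_Ioi] at hs
        simp only [Pi.neg_apply] at e
        linarith⟩
  coefficients := ⟨_, _, _, hζ₁, hζ₁.pow 2, hasCoefficients_specialI fun _ hq => ⟨hq.1, hq.2.ne'⟩⟩

lemma isNormalDomain_UIIminus (hI : IsOpen I) (hIc : I.OrdConnected)
    (hζ₁ : ContDiffOn ℝ ∞ ζ₁ I) : IsNormalDomain (specialII ζ₁) I (UIIminus I ζ₁) where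
  isOpen := isOpen_strip_lt hI ((continuousOn_const.mul continuousOn_fst).add
    (continuousOn_comp_snd hζ₁.continuousOn)) continuousOn_const
  isPreconnected := isPreconnected_of_mem_iff hIc (ordConnected_Iio (a := 0))
    (hζ₁.continuousOn.neg.div_const 2) (continuousOn_const (c := 1)) fun q =>
      and_congr_right fun _ => ⟨fun h => ⟨q.1 + ζ₁ q.2 / 2, by rw [mem_Iio]; linarith, by
        simp only [Pi.neg_apply]; ring⟩, fun ⟨s, hs, e⟩ => by
        rw [mem_Iio] at hs
        simp only [Pi.neg_apply] at e
        linarith⟩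
  coefficients := ⟨_, _, _, contDiffOn_const, contDiffOn_const.mul hζ₁,
    hasCoefficients_specialII (σ := -1) (by norm_num) fun _ hq => ⟨hq.1, by linarith [hq.2]⟩⟩

lemma isNormalDomain_UIIplus (hI : IsOpen I) (hIc : I.OrdConnected)
    (hζ₁ : ContDiffOn ℝ ∞ ζ₁ I) : IsNormalDomain (specialII ζ₁) I (UIIplus I ζ₁) where
  isOpen := isOpen_strip_lt hI continuousOn_const ((continuousOn_const.mul continuousOn_fst).add
    (continuousOn_comp_snd hζ₁.continuousOn))
  isPreconnected := isPreconnected_of_mem_iff hIc (ordConnected_Ioi (a := 0))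
    (hζ₁.continuousOn.neg.div_const 2) (continuousOn_const (c := 1)) fun q =>
      and_congr_right fun _ => ⟨fun h => ⟨q.1 + ζ₁ q.2 / 2, by rw [mem_Ioi]; linarith, by
        simp only [Pi.neg_apply]; ring⟩, fun ⟨s, hs, e⟩ => by
        rw [mem_Ioi] at hs
        simp only [Pi.neg_apply] at e
        linarith⟩
  coefficients := ⟨_, _, _, contDiffOn_const, contDiffOn_const.mul hζ₁,
    hasCoefficients_specialII (σ := 1) (by norm_num) fun _ hq => ⟨hq.1, by linarith [hq.2]⟩⟩

lemma isNormalDomain_general (hζ₁ : ContDiffOn ℝ ∞ ζ₁ I) (hζ₂ : ContDiffOn ℝ ∞ ζ₂ I)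
    (hD : IsOpen D) (hDc : IsPreconnected D) {ε : ℝ} (hε : ε ^ 2 = 1)
    (h : ∀ q ∈ D, q.2 ∈ I ∧ 0 < ε * ((q.1 + ζ₁ q.2) ^ 2 + ζ₂ q.2)) :
    IsNormalDomain (general ζ₁ ζ₂) I D :=
  ⟨hD, hDc, _, _, _, contDiffOn_const.mul hζ₁, contDiffOn_const.mul ((hζ₁.pow 2).add hζ₂),
    hasCoefficients_general hε h⟩

lemma isNormalDomain_VI (hI : IsOpen I) (hIc : I.OrdConnected) (hζ₁ : ContDiffOn ℝ ∞ ζ₁ I)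
    (hζ₂ : ContDiffOn ℝ ∞ ζ₂ I) (hpos : ∀ y ∈ I, 0 < ζ₂ y) :
    IsNormalDomain (general ζ₁ ζ₂) I (VI I) := by
  refine isNormalDomain_general hζ₁ hζ₂ (hI.preimage continuous_snd) ?_ (ε := 1) (by norm_num)
    fun q hq => ⟨hq, by have := hpos _ hq; positivity⟩
  refine isPreconnected_of_mem_iff hIc ordConnected_univ (m := fun _ => 0) (r := fun _ => 1)
    continuousOn_const continuousOn_const fun q => ⟨fun h => ⟨h, q.1, trivial, by simp⟩, And.left⟩

lemma isNormalDomain_VIIminus (hI : IsOpen I) (hIc : I.OrdConnected)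
    (hζ₁ : ContDiffOn ℝ ∞ ζ₁ I) (hζ₂ : ContDiffOn ℝ ∞ ζ₂ I) (hneg : ∀ y ∈ I, ζ₂ y < 0) :
    IsNormalDomain (general ζ₁ ζ₂) I (VIIminus I ζ₁ ζ₂) := by
  have hm : ContinuousOn (fun y => -ζ₁ y - √(-ζ₂ y)) I :=
    hζ₁.continuousOn.neg.sub hζ₂.continuousOn.neg.sqrt
  refine isNormalDomain_general hζ₁ hζ₂
    (isOpen_strip_lt hI continuousOn_fst (continuousOn_comp_snd hm)) ?_ (ε := 1) (by norm_num)
    fun q hq => ⟨hq.1, ?_⟩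
  · exact isPreconnected_of_mem_iff hIc (ordConnected_Iio (a := 0)) hm
      (continuousOn_const (c := 1)) fun q => and_congr_right fun _ =>
        ⟨fun h => ⟨q.1 - (-ζ₁ q.2 - √(-ζ₂ q.2)), sub_neg.2 h, by ring⟩, fun ⟨s, hs, e⟩ => by
          rw [mem_Iio] at hs
          linarith⟩
  · have h1 := Real.sq_sqrt (neg_pos.2 (hneg _ hq.1)).le
    have h2 := Real.sqrt_nonneg (-ζ₂ q.2)
    have h3 := hq.2
    nlinarith

lemma isNormalDomain_VIIplus (hI : IsOpen I) (hIc : I.OrdConnected)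
    (hζ₁ : ContDiffOn ℝ ∞ ζ₁ I) (hζ₂ : ContDiffOn ℝ ∞ ζ₂ I) (hneg : ∀ y ∈ I, ζ₂ y < 0) :
    IsNormalDomain (general ζ₁ ζ₂) I (VIIplus I ζ₁ ζ₂) := by
  have hm : ContinuousOn (fun y => -ζ₁ y + √(-ζ₂ y)) I :=
    hζ₁.continuousOn.neg.add hζ₂.continuousOn.neg.sqrt
  refine isNormalDomain_general hζ₁ hζ₂
    (isOpen_strip_lt hI (continuousOn_comp_snd hm) continuousOn_fst) ?_ (ε := 1) (by norm_num)
    fun q hq => ⟨hq.1, ?_⟩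
  · exact isPreconnected_of_mem_iff hIc (ordConnected_Ioi (a := 0)) hm
      (continuousOn_const (c := 1)) fun q => and_congr_right fun _ =>
        ⟨fun h => ⟨q.1 - (-ζ₁ q.2 + √(-ζ₂ q.2)), sub_pos.2 h, by ring⟩, fun ⟨s, hs, e⟩ => by
          rw [mem_Ioi] at hs
          linarith⟩
  · have h1 := Real.sq_sqrt (neg_pos.2 (hneg _ hq.1)).le
    have h2 := Real.sqrt_nonneg (-ζ₂ q.2)
    have h3 := hq.2
    nlinarith

lemma isNormalDomain_VIII (hI : IsOpen I) (hIc : I.OrdConnected)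
    (hζ₁ : ContDiffOn ℝ ∞ ζ₁ I) (hζ₂ : ContDiffOn ℝ ∞ ζ₂ I) (hneg : ∀ y ∈ I, ζ₂ y < 0) :
    IsNormalDomain (general ζ₁ ζ₂) I (VIII I ζ₁ ζ₂) := by
  have hr : ContinuousOn (fun y => √(-ζ₂ y)) I := hζ₂.continuousOn.neg.sqrt
  have hopen : IsOpen (VIII I ζ₁ ζ₂) := by
    have := (isOpen_strip_lt hI (continuousOn_comp_snd (hζ₁.continuousOn.neg.sub hr))
      continuousOn_fst).inter (isOpen_strip_lt hI continuousOn_fst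
        (continuousOn_comp_snd (hζ₁.continuousOn.neg.add hr)))
    convert this using 1
    ext q
    exact ⟨fun h => ⟨⟨h.1, h.2.1⟩, h.1, h.2.2⟩, fun h => ⟨h.1.1, h.1.2, h.2.2⟩⟩
  refine isNormalDomain_general hζ₁ hζ₂ hopen ?_ (ε := -1) (by norm_num) fun q hq => ⟨hq.1, ?_⟩
  · refine isPreconnected_of_mem_iff hIc (ordConnected_Ioo (a := -1) (b := 1))
      hζ₁.continuousOn.neg hr fun q => and_congr_right fun hq => ?_
    have h0 : 0 < √(-ζ₂ q.2) := Real.sqrt_pos.2 (neg_pos.2 (hneg _ hq))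
    constructor
    · rintro ⟨h1, h2⟩
      refine ⟨(q.1 + ζ₁ q.2) / √(-ζ₂ q.2), ⟨?_, ?_⟩, ?_⟩
      · rw [lt_div_iff₀ h0]
        linarith
      · rw [div_lt_iff₀ h0]
        linarith
      · rw [div_mul_cancel₀ _ h0.ne']
        simp
    · rintro ⟨s, ⟨h1, h2⟩, e⟩
      simp only [Pi.neg_apply] at e
      constructor <;> nlinarith
  · have h1 := Real.sq_sqrt (neg_pos.2 (hneg _ hq.1)).le
    have h2 := hq.2
    -- With `r = √(-ζ₂)` the product is `(w + r)(r - w) = -(w² + ζ₂)`.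
    nlinarith [mul_pos (sub_pos.2 h2.1) (sub_pos.2 h2.2)]

end Heis

end

/-! ### The main theorem -/

theorem theorem1p7
    (I : Set ℝ) (hI : IsOpen I) (hI_interval : I.OrdConnected)
    (ζ₁ ζ₂ : ℝ → ℝ) (hζ₁ : ContDiffOn ℝ ∞ ζ₁ I) (hζ₂ : ContDiffOn ℝ ∞ ζ₂ I)
    (hζ₂_ne : ∀ y ∈ I, ζ₂ y ≠ 0) :
    -- the eight surfaces are immersed `p`-minimal surfaces, well defined up to congruence
    Heis.IsWellDefinedSurface (Heis.specialI ζ₁) (Heis.UIminus I ζ₁) ∧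
    Heis.IsWellDefinedSurface (Heis.specialI ζ₁) (Heis.UIplus I ζ₁) ∧
    Heis.IsWellDefinedSurface (Heis.specialII ζ₁) (Heis.UIIminus I ζ₁) ∧
    Heis.IsWellDefinedSurface (Heis.specialII ζ₁) (Heis.UIIplus I ζ₁) ∧
    ((∀ y ∈ I, 0 < ζ₂ y) →
      Heis.IsWellDefinedSurface (Heis.general ζ₁ ζ₂) (Heis.VI I)) ∧
    ((∀ y ∈ I, ζ₂ y < 0) →
      Heis.IsWellDefinedSurface (Heis.general ζ₁ ζ₂) (Heis.VIIminus I ζ₁ ζ₂) ∧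
      Heis.IsWellDefinedSurface (Heis.general ζ₁ ζ₂) (Heis.VIIplus I ζ₁ ζ₂) ∧
      Heis.IsWellDefinedSurface (Heis.general ζ₁ ζ₂) (Heis.VIII I ζ₁ ζ₂)) ∧
    -- they are maximal
    (∀ (M : Type*) [TopologicalSpace M] [ChartedSpace (ℝ × ℝ) M]
      [IsManifold 𝓘(ℝ, ℝ × ℝ) ∞ M] [ConnectedSpace M]
      (F : M → Heis.H1) (φ : M → ℝ × ℝ), Heis.IsPMinimalSurface F →
      (Heis.IsOfSpecialTypeI I ζ₁ F φ →
        Heis.IsPartOf F φ (Heis.specialI ζ₁) (Heis.UIminus I ζ₁) ∨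
        Heis.IsPartOf F φ (Heis.specialI ζ₁) (Heis.UIplus I ζ₁)) ∧
      (Heis.IsOfSpecialTypeII I ζ₁ F φ →
        Heis.IsPartOf F φ (Heis.specialII ζ₁) (Heis.UIIminus I ζ₁) ∨
        Heis.IsPartOf F φ (Heis.specialII ζ₁) (Heis.UIIplus I ζ₁)) ∧
      (Heis.IsOfTypeI I ζ₁ ζ₂ F φ →
        Heis.IsPartOf F φ (Heis.general ζ₁ ζ₂) (Heis.VI I)) ∧
      (Heis.IsOfTypeII I ζ₁ ζ₂ F φ →
        Heis.IsPartOf F φ (Heis.general ζ₁ ζ₂) (Heis.VIIminus I ζ₁ ζ₂) ∨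
        Heis.IsPartOf F φ (Heis.general ζ₁ ζ₂) (Heis.VIIplus I ζ₁ ζ₂)) ∧
      (Heis.IsOfTypeIII I ζ₁ ζ₂ F φ →
        Heis.IsPartOf F φ (Heis.general ζ₁ ζ₂) (Heis.VIII I ζ₁ ζ₂))) := by
  -- The types constrain `ζ₂` only at values of `y` attained on the surface. Since `ζ₂` has constant
  -- sign on `I` and `M` is nonempty, the sign holds on all of `I`.
  have hsign := Heis.pos_or_neg_of_isPreconnected hI_interval.isPreconnected hζ₂.continuousOn
    hζ₂_ne
  refine ⟨(Heis.isNormalDomain_UIminus hI hI_interval hζ₁).isWellDefinedSurface hI hI_interval,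
    (Heis.isNormalDomain_UIplus hI hI_interval hζ₁).isWellDefinedSurface hI hI_interval,
    (Heis.isNormalDomain_UIIminus hI hI_interval hζ₁).isWellDefinedSurface hI hI_interval,
    (Heis.isNormalDomain_UIIplus hI hI_interval hζ₁).isWellDefinedSurface hI hI_interval,
    fun h => (Heis.isNormalDomain_VI hI hI_interval hζ₁ hζ₂ h).isWellDefinedSurface hI hI_interval,
    fun h =>
    ⟨(Heis.isNormalDomain_VIIminus hI hI_interval hζ₁ hζ₂ h).isWellDefinedSurface hI hI_interval,
     (Heis.isNormalDomain_VIIplus hI hI_interval hζ₁ hζ₂ h).isWellDefinedSurface hI hI_interval,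
     (Heis.isNormalDomain_VIII hI hI_interval hζ₁ hζ₂ h).isWellDefinedSurface hI hI_interval⟩,
    ?_⟩
  intro M _ _ _ _ F φ hF
  have hneg {p : M} (hp : (φ p).2 ∈ I ∧ ζ₂ (φ p).2 < 0) : ∀ y ∈ I, ζ₂ y < 0 :=
    hsign.resolve_left fun h => (h _ hp.1).not_gt hp.2
  have hcont {N : Heis.NormalForm} (hφ : Heis.IsNormalCoordinates N F φ) : Continuous φ :=
    hφ.localDiffeo.contMDiff.continuous
  have hcont' {h : ℝ → ℝ} (hφ : Continuous φ) (hh : ContinuousOn h I) (hm : ∀ p, (φ p).2 ∈ I) :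
      Continuous fun p => h (φ p).2 :=
    hh.comp_continuous hφ.snd hm
  obtain ⟨p₀⟩ : Nonempty M := inferInstance
  refine ⟨fun ⟨hN, h⟩ => ?_, fun ⟨hN, h⟩ => ?_, fun ⟨hN, h⟩ => ?_, fun ⟨hN, h⟩ => ?_,
    fun ⟨hN, h⟩ => ?_⟩
  · have hc := hcont hN
    rcases Heis.pos_or_neg_of_isPreconnected isPreconnected_univ
      (hc.fst.add (hcont' hc hζ₁.continuousOn fun p => (h p).1)).continuousOn
      (fun p _ => (h p).2) with hs | hs
    · exact .inr ((Heis.isNormalDomain_UIplus hI hI_interval hζ₁).isPartOf hI hI_interval hF hN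
        fun p => ⟨(h p).1, hs p trivial⟩)
    · exact .inl ((Heis.isNormalDomain_UIminus hI hI_interval hζ₁).isPartOf hI hI_interval hF hN
        fun p => ⟨(h p).1, hs p trivial⟩)
  · have hc := hcont hN
    rcases Heis.pos_or_neg_of_isPreconnected isPreconnected_univ
      ((continuous_const.mul hc.fst).add
        (hcont' hc hζ₁.continuousOn fun p => (h p).1)).continuousOn
      (fun p _ => (h p).2) with hs | hs
    · exact .inr ((Heis.isNormalDomain_UIIplus hI hI_interval hζ₁).isPartOf hI hI_interval hF hN
        fun p => ⟨(h p).1, hs p trivial⟩)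
    · exact .inl ((Heis.isNormalDomain_UIIminus hI hI_interval hζ₁).isPartOf hI hI_interval hF hN
        fun p => ⟨(h p).1, hs p trivial⟩)
  · exact (Heis.isNormalDomain_VI hI hI_interval hζ₁ hζ₂
      (hsign.resolve_right fun h' => (h' _ (h p₀).1).not_gt (h p₀).2)).isPartOf hI hI_interval
        hF hN fun p => (h p).1
  · have hc := hcont hN
    have hn := hneg ⟨(h p₀).1, (h p₀).2.1⟩
    have hr : ∀ p, 0 < √(-ζ₂ (φ p).2) := fun p => Real.sqrt_pos.2 (neg_pos.2 (h p).2.1)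
    have hw : Continuous fun p => (φ p).1 + ζ₁ (φ p).2 :=
      hc.fst.add (hcont' hc hζ₁.continuousOn fun p => (h p).1)
    -- For type II, `|x + ζ₁| > √(-ζ₂) > 0`, so the sign of `x + ζ₁` is constant on `M` and tells
    -- the two domains apart.
    rcases Heis.pos_or_neg_of_isPreconnected isPreconnected_univ hw.continuousOn
      (fun p _ => by
        have := hr p
        rcases (h p).2.2 with h | h
        · exact ne_of_lt (by linarith)
        · exact ne_of_gt (by linarith)) with hs | hs
    · refine .inr ((Heis.isNormalDomain_VIIplus hI hI_interval hζ₁ hζ₂ hn).isPartOf hI hI_interval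
        hF hN fun p => ⟨(h p).1, (h p).2.2.resolve_left fun h' => ?_⟩)
      linarith [hs p trivial, hr p]
    · refine .inl ((Heis.isNormalDomain_VIIminus hI hI_interval hζ₁ hζ₂ hn).isPartOf hI hI_interval
        hF hN fun p => ⟨(h p).1, (h p).2.2.resolve_right fun h' => ?_⟩)
      linarith [hs p trivial, hr p]
  · exact (Heis.isNormalDomain_VIII hI hI_interval hζ₁ hζ₂ (hneg ⟨(h p₀).1, (h p₀).2.1⟩)).isPartOf
      hI hI_interval hF hN fun p => ⟨(h p).1, (h p).2.2⟩
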